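/- **Setting.** Let $r\ge 2$, $s\ge 2$, and let $\mathfrak g$ be the free nilpotent real Lie algebra of rank $r$ and step $s$. Let $X_1,\dots,X_n$ be a Hall basis of $\mathfrak g$: $X_1,\dots,X_r$ are the free generators (degree $1$), the basis is ordered so that $\deg X_i<\deg X_j$ implies $i<j$, and a bracket $[X_i,X_j]$ of degree $\deg X_i+\deg X_j\le s$ belongs to the basis if and only if $i>j$ and, in case $X_i$ was constructed as $[X_h,X_k]$, also $k\le j$. Every $X_\ell$ is uniquely of the form $X_\ell=[\cdots[[X_{\ell_0},X_{\ell_1}],X_{\ell_2}],\dots,X_{\ell_h}]$ with $\ell_0\le r$; let $I(\ell)\in\mathbb N^n$ be the multi-index $I(\ell)_j=\#\{p\ge 1:\ell_p=j\}$. The free nilpotent group $G$ with Lie algebra $\mathfrak g$ is identified with $\mathbb R^n$ by the exponential coordinates of the second type of this basis, in which the generators are the left-invariant vector fields $$X_i(x)=\sum_{\ell:\ \ell_0=i}\frac{(-1)^{|I(\ell)|}}{I(\ell)!}\,x^{I(\ell)}\,\frac{\partial}{\partial x_\ell},\qquad i=1,\dots,r .$$ For $\alpha\in\mathbb N^n$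 let $[X_i,X_\alpha]$ be the left-nested bracket of $X_i$ with $\alpha_1$ times $X_1$, then $\alpha_2$ times $X_2$, …, then $\alpha_n$ times $X_n$, write $[X_i,X_\alpha]=\sum_k c_{i\alpha}^kX_k$, and for $v\in\mathbb R^n$ put $$P_i^v(x)=\sum_{\alpha\in\mathbb N^n}\frac{(-1)^{|\alpha|}}{\alpha!}\Big(\sum_{k=1}^n c_{i\alpha}^kv_k\Big)x^\alpha,\qquad Z_v=\{x\in\mathbb R^n:P_1^v(x)=\dots=P_r^v(x)=0\}.$$ A Lipschitz curve $\gamma:[0,1]\to\mathbb R^n$ is horizontal with controls $h\in L^\infty([0,1];\mathbb R^r)$ if $\dot\gamma=\sum_{j=1}^r h_jX_j(\gamma)$ a.e. It is an abnormal extremal if there is a Lipschitz curve $\xi:[0,1]\to\mathbb R^n$, nowhere zero, with $\langle\xi,X_j(\gamma)\rangle=0$ on $[0,1]$ for $j=1,\dots,r$ and, writing $X_j=\sum_i X_{ji}\,\partial/\partial x_i$, $\dot\xi_k=-\sum_{j=1}^r\sum_{i=1}^n\frac{\partial X_{ji}}{\partial x_k}(\gamma)h_j\xi_i$ a.e. for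 $k=1,\dots,n$. Its corank is $n-\dim\operatorname{Im}d\mathcal E(h)$, where $\mathcal E:L^2([0,1];\mathbb R^r)\to\mathbb R^n$ is the end-point map: $\mathcal E(u)$ is the value at time $1$ of the solution of $\dot\gamma^u=\sum_j u_jX_j(\gamma^u)$, $\gamma^u(0)=\gamma(0)$. **Theorem.** Let $\gamma:[0,1]\to G=\mathbb R^n$ be a horizontal curve with $\gamma(0)=0$ and let $m\ge 1$. The following are equivalent: - (A) $\gamma$ is an abnormal extremal of corank at least $m$; - (B) there are $m$ linearly independent vectors $v_1,\dots,v_m\in\mathbb R^n$ such that $\gamma(t)\in Z_{v_1}\cap\dots\cap Z_{v_m}$ for all $t\in[0,1]$. Moreover, $\gamma$ is an abnormal extremal of corank exactly $m$ if and only if (B) holds for $m$ and fails for $m+1$. -/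

import Mathlib

open MeasureTheory Set

noncomputable section

/-! ## Horizontal curves, abnormal extremals, end-point map and corank

Everything in this section is for a family `X 0, …, X (r-1)` of vector fields on `ℝⁿ`. -/

/-- Lebesgue measure on `[0,1]`. -/
abbrev unitVolume : Measure ℝ := volume.restrict (Icc (0 : ℝ) 1)

/-- The Hilbert space of controls `L²([0,1]; ℝʳ)`. -/
abbrev ControlSpace (r : ℕ) : Type := Lp (EuclideanSpace ℝ (Fin r)) 2 unitVolume

/-- The Lipschitz curve `γ : [0,1] → ℝⁿ` (only the values on `[0,1]` matter) is horizontal with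
controls `h ∈ L^∞([0,1]; ℝʳ)`: `γ' = ∑ j, h j • X j (γ)` almost everywhere on `[0,1]`. -/
structure IsHorizontal {r n : ℕ} (X : Fin r → (Fin n → ℝ) → (Fin n → ℝ))
    (γ : ℝ → (Fin n → ℝ)) (h : ℝ → EuclideanSpace ℝ (Fin r)) : Prop where
  lipschitz : ∃ K : NNReal, LipschitzOnWith K γ (Icc 0 1)
  controls_memLp : MemLp h ⊤ unitVolume
  hasDerivAt : ∀ᵐ t ∂unitVolume, HasDerivAt γ (∑ j, h t j • X j (γ t)) t

/-- The horizontal curve `γ` with controls `h` is an abnormal extremal: there is a Lipschitz curve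
`ξ : [0,1] → ℝⁿ`, nowhere zero, with `⟨ξ, X j (γ)⟩ = 0` on `[0,1]` for all `j`, which solves the
adjoint equations `ξ k' = - ∑ j, ∑ i, (∂ (X j) i / ∂ x k)(γ) * h j * ξ i` a.e. on `[0,1]`. -/
def IsAbnormalExtremal {r n : ℕ} (X : Fin r → (Fin n → ℝ) → (Fin n → ℝ))
    (γ : ℝ → (Fin n → ℝ)) (h : ℝ → EuclideanSpace ℝ (Fin r)) : Prop :=
  ∃ ξ : ℝ → (Fin n → ℝ),
    (∃ K : NNReal, LipschitzOnWith K ξ (Icc 0 1)) ∧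
    (∀ t ∈ Icc (0 : ℝ) 1, ξ t ≠ 0) ∧
    (∀ t ∈ Icc (0 : ℝ) 1, ∀ j, ∑ i, ξ t i * X j (γ t) i = 0) ∧
    (∀ᵐ t ∂unitVolume, ∀ k, HasDerivAt (fun τ => ξ τ k)
      (-∑ j, ∑ i, fderiv ℝ (fun x => X j x i) (γ t) (Pi.single k 1) * h t j * ξ t i) t)

/-- `γ` is the (Carathéodory) solution on `[0,1]` of `γ' = ∑ j, u j • X j (γ)`, `γ 0 = x₀`. -/
def IsTrajectory {r n : ℕ} (X : Fin r → (Fin n → ℝ) → (Fin n → ℝ)) (x₀ : Fin n → ℝ)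
    (u : ControlSpace r) (γ : ℝ → (Fin n → ℝ)) : Prop :=
  ContinuousOn γ (Icc 0 1) ∧
    ∀ t ∈ Icc (0 : ℝ) 1, γ t = x₀ + ∫ τ in (0 : ℝ)..t, ∑ j, (u τ) j • X j (γ τ)

/-- The end-point map `L²([0,1]; ℝʳ) → ℝⁿ` with initial point `x₀`: it sends a control `u` to the
value at time `1` of the trajectory of `u` that starts at `x₀`. -/
def endpointMap {r n : ℕ} (X : Fin r → (Fin n → ℝ) → (Fin n → ℝ)) (x₀ : Fin n → ℝ)
    (u : ControlSpace r) : Fin n → ℝ :=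
  Classical.epsilon fun p => ∃ γ, IsTrajectory X x₀ u γ ∧ γ 1 = p

/-- The controls of a horizontal curve as an element of `L²([0,1]; ℝʳ)`. -/
def IsHorizontal.control {r n : ℕ} {X : Fin r → (Fin n → ℝ) → (Fin n → ℝ)}
    {γ : ℝ → (Fin n → ℝ)} {h : ℝ → EuclideanSpace ℝ (Fin r)} (hγ : IsHorizontal X γ h) :
    ControlSpace r :=
  (hγ.controls_memLp.mono_exponent (p := 2) le_top).toLp h

/-- The horizontal curve `γ` has corank `k`: the end-point map with initial point `γ 0` is
Fréchet differentiable at the controls of `γ`, and `k = n - dim (image of the differential)`. -/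
def IsHorizontal.HasCorank {r n : ℕ} {X : Fin r → (Fin n → ℝ) → (Fin n → ℝ)}
    {γ : ℝ → (Fin n → ℝ)} {h : ℝ → EuclideanSpace ℝ (Fin r)} (hγ : IsHorizontal X γ h)
    (k : ℕ) : Prop :=
  ∃ D : ControlSpace r →L[ℝ] (Fin n → ℝ),
    HasFDerivAt (endpointMap X (γ 0)) D hγ.control ∧
      k + Module.finrank ℝ (LinearMap.range D.toLinearMap) = n

/-! ## Free nilpotent Lie algebras and Hall bases -/

/-- The ideal of the free Lie algebra on `r` generators that is spanned by the brackets of more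
than `s` elements. (Mathlib's lower central series starts with the whole algebra at index `0`.) -/
abbrev freeNilpotentIdeal (r s : ℕ) : LieIdeal ℝ (FreeLieAlgebra ℝ (Fin r)) :=
  LieModule.lowerCentralSeries ℝ (FreeLieAlgebra ℝ (Fin r)) (FreeLieAlgebra ℝ (Fin r)) s

/-- The free nilpotent real Lie algebra of rank `r` and step `s`. -/
abbrev FreeNilpotentLieAlgebra (r s : ℕ) : Type :=
  FreeLieAlgebra ℝ (Fin r) ⧸ freeNilpotentIdeal r s

/-- The value in the free nilpotent Lie algebra of a formal bracketing of the generators. -/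
def evalBracket (r s : ℕ) : FreeMagma (Fin r) → FreeNilpotentLieAlgebra r s
  | .of i => LieSubmodule.Quotient.mk (N := freeNilpotentIdeal r s) (FreeLieAlgebra.of ℝ i)
  | .mul a b => ⁅evalBracket r s a, evalBracket r s b⁆

/-- The letter `ℓ₀` of a bracketing `[⋯[[ℓ₀, u₁], u₂], ⋯, u_h]`. -/
def headLetter {r : ℕ} : FreeMagma (Fin r) → Fin r
  | .of i => i
  | .mul a _ => headLetter a

/-- The number of indices `p ≥ 1` with `u_p = u` in a bracketing `[⋯[[ℓ₀, u₁], u₂], ⋯, u_h]`,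
where `ℓ₀` is a letter. -/
def spineCount {r : ℕ} (u : FreeMagma (Fin r)) : FreeMagma (Fin r) → ℕ
  | .of _ => 0
  | .mul a b => spineCount u a + if b = u then 1 else 0

/-- The result of M. Hall's algorithm in rank `r` and step `s`: a list of `n` formal bracketings of
the generators. The list is ordered compatibly with the degree (the number of letters) and
starts with the `r` generators; a bracket `[a, b]` is in the list if and only if its degree is at
most `s`, `a` is the `i`-th and `b` the `j`-th element of the list for some `i > j`, and, if the
`i`-th element was constructed as a bracket with the `k`-th element on the right, then `k ≤ j`. -/
structure HallBasis (r s n : ℕ) where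
  word : Fin n → FreeMagma (Fin r)
  word_injective : Function.Injective word
  rank_le : r ≤ n
  word_castLE : ∀ i : Fin r, word (Fin.castLE rank_le i) = FreeMagma.of i
  lt_of_length_lt : ∀ i j, (word i).length < (word j).length → i < j
  mul_mem_iff : ∀ a b : FreeMagma (Fin r), (∃ l, word l = a * b) ↔
    (a * b).length ≤ s ∧ ∃ i j, word i = a ∧ word j = b ∧ j < i ∧
      ∀ c k, word i = c * word k → k ≤ j

namespace HallBasis

variable {r s n : ℕ} (H : HallBasis r s n)

/-- The position in the Hall basis of the `i`-th generator. -/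
def gen (i : Fin r) : Fin n := Fin.castLE H.rank_le i

/-- The element `X_l` of the Hall basis, in the free nilpotent Lie algebra. -/
def elt (l : Fin n) : FreeNilpotentLieAlgebra r s := evalBracket r s (H.word l)

/-- The multi-index `I(l)`: if `X_l = [⋯[[X_{l₀}, X_{l₁}], X_{l₂}], ⋯, X_{l_h}]` with `X_{l₀}` a
generator, then `I(l) j` is the number of `p ≥ 1` with `l_p = j`. -/
def multiIndex (l : Fin n) (j : Fin n) : ℕ := spineCount (H.word j) (H.word l)

/-- The generating vector fields of the free nilpotent group `ℝⁿ`, `i = 1, …, r`: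
`X_i(x) = ∑_{l : l₀ = i} (-1)^|I(l)| / I(l)! * x^I(l) ∂/∂x_l`. -/
def vectorField (i : Fin r) (x : Fin n → ℝ) : Fin n → ℝ := fun l =>
  if headLetter (H.word l) = i then
    (-1) ^ (∑ j, H.multiIndex l j) / (∏ j, ((H.multiIndex l j).factorial : ℝ)) *
      ∏ j, x j ^ H.multiIndex l j
  else 0

/-- The iterated bracket `[y, X_α] = [y, X_1, …, X_1, X_2, …, X_2, …, X_n, …, X_n]`, nested to the
left, where each `X_k` occurs `α k` times. -/
def iteratedBracket (y : FreeNilpotentLieAlgebra r s) (α : Fin n → ℕ) :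
    FreeNilpotentLieAlgebra r s :=
  (List.finRange n).foldl (fun z k => (fun w => ⁅w, H.elt k⁆)^[α k] z) y

/-- The coordinates of `y` in the Hall basis: the unique `c` with `y = ∑ k, c k • X_k`. -/
def coords (y : FreeNilpotentLieAlgebra r s) : Fin n → ℝ :=
  Classical.epsilon fun c => y = ∑ k, c k • H.elt k

/-- The generalized structure constants: `[X_i, X_α] = ∑ k, c_{iα}^k X_k`. -/
def structureConst (i : Fin n) (α : Fin n → ℕ) (k : Fin n) : ℝ :=
  H.coords (H.iteratedBracket (H.elt i) α) k

/-- `φ_{iα}(v) = (-1)^|α| / α! * ∑ k, c_{iα}^k v_k`. -/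
def phi (i : Fin n) (α : Fin n → ℕ) (v : Fin n → ℝ) : ℝ :=
  (-1) ^ (∑ j, α j) / (∏ j, ((α j).factorial : ℝ)) * ∑ k, H.structureConst i α k * v k

/-- The extremal polynomial `P_i^v(x) = ∑_{α ∈ ℕⁿ} φ_{iα}(v) x^α`; only finitely many `φ_{iα}` are
different from `0`, by nilpotency. -/
def extremalPolynomial (i : Fin n) (v x : Fin n → ℝ) : ℝ :=
  ∑ᶠ α : Fin n → ℕ, H.phi i α v * ∏ j, x j ^ α j

/-- `Z_v = {x : P_1^v(x) = ⋯ = P_r^v(x) = 0}`. -/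
def abnormalVariety (v : Fin n → ℝ) : Set (Fin n → ℝ) :=
  {x | ∀ i : Fin r, H.extremalPolynomial (H.gen i) v x = 0}

/-- There are `m` linearly independent vectors `v₁, …, v_m` such that `γ` stays in the
abnormal variety `Z_{v₁} ∩ ⋯ ∩ Z_{v_m}` on `[0,1]`. -/
def LiesInAbnormalVariety (γ : ℝ → (Fin n → ℝ)) (m : ℕ) : Prop :=
  ∃ v : Fin m → (Fin n → ℝ), LinearIndependent ℝ v ∧
    ∀ t ∈ Icc (0 : ℝ) 1, γ t ∈ ⋂ l, H.abnormalVariety (v l)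

end HallBasis

end

/-! A vector `v` is read as a covector on the Lie algebra through the dual Hall basis, and extended
to the right-invariant one-form `rightInvariantForm` with value `v` at the origin. Pairing this form
with the generator `X_i` gives exactly the polynomial `P_i^v` (`sum_rightInvariantForm_mul`).
Right-invariant forms are preserved by the flows of left-invariant fields, so along every horizontal
curve they solve the adjoint equation (`ae_hasDerivAt_rightInvariantForm`). They are nowhere zero if
`v ≠ 0`, and at each point they fill the whole cotangent space (`rightInvariantFormEquiv`).

Integration by parts against the linearised control system then gives, for each direction `w` in
control space, the duality `⟨ξ_v(γ(1)), dE(h) w⟩ = ∫ ∑ j, w_j P_j^v(γ)`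
(`sum_rightInvariantForm_mul_fderiv_trajectory`). Hence the annihilator of the image of `dE(h)`
corresponds to the space of all `v` such that `γ` stays in `Z_v` (`map_abnormalCovectors`), and the
corank is the dimension of that space (`hasCorank_iff`). Both equivalences of the theorem compare
this dimension with `m`; abnormality follows from a single nonzero `v`.

Two preparations take most of the work. The Hall elements must be a basis: they span by Hall's
rewriting with the Jacobi identity (`span_range_elt`), and they are independent because the given
polynomial fields realise the bracketing `X_l` as a field equal to `∂/∂x_l` at the origin
(`linearIndependent_elt`). The explicit fields must also be the left-invariant ones:
`sum_vectorField_smul_maurerCartan` proves that the right Maurer-Cartan form sends `X_i(x)` to the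
adjoint transform of the generator, by applying the exponentials one at a time and following the
Hall elements that they create. -/

noncomputable section

/-! ### Spines of formal bracketings -/

section Spine

variable {r : ℕ}

@[simp] theorem spineCount_of (u : FreeMagma (Fin r)) (i : Fin r) :
    spineCount u (FreeMagma.of i) = 0 := rfl

@[simp] theorem spineCount_mul (u a b : FreeMagma (Fin r)) :
    spineCount u (a * b) = spineCount u a + if b = u then 1 else 0 := rfl

@[simp] theorem headLetter_of (i : Fin r) : headLetter (FreeMagma.of i) = i := rfl

@[simp] theorem headLetter_mul (a b : FreeMagma (Fin r)) :
    headLetter (a * b) = headLetter a := rfl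

theorem length_lt_of_spineCount_pos {u w : FreeMagma (Fin r)} (h : 0 < spineCount u w) :
    u.length < w.length := by
  induction w with
  | ih1 i => simp at h
  | ih2 a b iha _ =>
    have hmul : (a * b).length = a.length + b.length := rfl
    rw [hmul]
    by_cases hb : b = u
    · subst hb
      have := a.length_pos
      omega
    · have : 0 < spineCount u a := by simpa [hb] using h
      have := iha this
      omega

/-- The bracketing `[⋯[[a, b], b], ⋯, b]` in which `b` occurs `m` times on the right. -/
def mulRightPow (a b : FreeMagma (Fin r)) (m : ℕ) : FreeMagma (Fin r) := (· * b)^[m] a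

@[simp] theorem mulRightPow_zero (a b : FreeMagma (Fin r)) : mulRightPow a b 0 = a := rfl

theorem mulRightPow_succ (a b : FreeMagma (Fin r)) (m : ℕ) :
    mulRightPow a b (m + 1) = mulRightPow a b m * b :=
  Function.iterate_succ_apply' _ _ _

theorem spineCount_mulRightPow (u a b : FreeMagma (Fin r)) (m : ℕ) :
    spineCount u (mulRightPow a b m) = spineCount u a + if b = u then m else 0 := by
  induction m with
  | zero => simp
  | succ m ih => rw [mulRightPow_succ, spineCount_mul, ih]; split_ifs <;> omega

@[simp] theorem headLetter_mulRightPow (a b : FreeMagma (Fin r)) (m : ℕ) :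
    headLetter (mulRightPow a b m) = headLetter a := by
  induction m with
  | zero => rfl
  | succ m ih => rw [mulRightPow_succ, headLetter_mul, ih]

theorem lt_length_mulRightPow (a b : FreeMagma (Fin r)) (m : ℕ) :
    m < (mulRightPow a b m).length := by
  induction m with
  | zero => exact a.length_pos
  | succ m ih =>
    have hmul : (mulRightPow a b m * b).length = (mulRightPow a b m).length + b.length := rfl
    have := b.length_pos
    rw [mulRightPow_succ, hmul]
    omega

end Spine

/-! ### Combinatorics of Hall bases -/

namespace HallBasis

variable {r s n : ℕ} (H : HallBasis r s n)

theorem word_eq_mul {l : Fin n} {a b : FreeMagma (Fin r)} (h : H.word l = a * b) :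
    (a * b).length ≤ s ∧ ∃ i j, H.word i = a ∧ H.word j = b ∧ j < i ∧
      ∀ c k, H.word i = c * H.word k → k ≤ j :=
  (H.mul_mem_iff a b).1 ⟨l, h⟩

/-- The Hall condition, applied at every step down the left factor, makes the spine weakly
increasing from left to right. The word is a separate variable so that induction on the magma
applies. -/
theorem le_of_spineCount_pos {k : Fin n} : ∀ {w c : FreeMagma (Fin r)} {i j : Fin n},
    H.word i = w → w = c * H.word j → 0 < spineCount (H.word k) w → k ≤ j := by
  intro w
  induction w with
  | ih1 x =>
    intro c i j _ _ hk
    simp at hk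
  | ih2 a b iha _ =>
    intro c i j hi hw hk
    obtain ⟨_, i', j', hi', hj', _, hle⟩ := H.word_eq_mul hi
    have hbj : b = H.word j := by injection hw
    have hjj : j' = j := H.word_injective (hj'.trans hbj)
    subst hjj
    by_cases hbk : b = H.word k
    · exact (H.word_injective (hbk.symm.trans hj'.symm)).le
    · have hk' : 0 < spineCount (H.word k) a := by simpa [hbk] using hk
      rcases ha : a with x | ⟨e, f⟩
      · rw [ha] at hk'; exact absurd hk' (lt_irrefl _)
      · have hi'' : H.word i' = e * f := hi'.trans ha
        obtain ⟨_, _, j₂, _, hj₂, _, _⟩ := H.word_eq_mul hi''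
        have h1 : k ≤ j₂ := iha hi' (c := e) (by rw [hj₂]; exact ha) hk'
        exact h1.trans (hle e j₂ (by rw [hj₂]; exact hi''))

/-- The entries of the spine of a Hall element do not exceed the last one. -/
theorem multiIndex_le_last {i j k : Fin n} {c : FreeMagma (Fin r)} (h : H.word i = c * H.word j)
    (hk : 0 < H.multiIndex i k) : k ≤ j :=
  H.le_of_spineCount_pos rfl h hk

theorem length_lt_of_multiIndex_pos {l j : Fin n} (h : 0 < H.multiIndex l j) :
    (H.word j).length < (H.word l).length :=
  length_lt_of_spineCount_pos h

theorem lt_of_multiIndex_pos {l j : Fin n} (h : 0 < H.multiIndex l j) : j < l :=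
  H.lt_of_length_lt _ _ (H.length_lt_of_multiIndex_pos h)

theorem multiIndex_of_eq_mulRightPow {l l' k : Fin n} {m : ℕ}
    (h : H.word l' = mulRightPow (H.word l) (H.word k) m) (j : Fin n) :
    H.multiIndex l' j = H.multiIndex l j + if k = j then m else 0 := by
  unfold multiIndex
  rw [h, spineCount_mulRightPow]
  simp only [H.word_injective.eq_iff]

theorem length_word_le (hs : 1 ≤ s) (l : Fin n) : (H.word l).length ≤ s := by
  rcases h : H.word l with i | ⟨a, b⟩
  · exact hs
  · exact (H.word_eq_mul h).1

/-- Right brackets of a Hall element with a smaller one that is not less than its spine are Hall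
elements, as long as the degree allows it. -/
theorem exists_word_eq_mulRightPow {l k : Fin n} (hkl : k < l)
    (hl : ∀ j, 0 < H.multiIndex l j → j ≤ k) {m : ℕ}
    (hm : (mulRightPow (H.word l) (H.word k) m).length ≤ s) :
    ∃ l', H.word l' = mulRightPow (H.word l) (H.word k) m ∧ k < l' ∧
      ∀ j, 0 < H.multiIndex l' j → j ≤ k := by
  induction m with
  | zero => exact ⟨l, rfl, hkl, hl⟩
  | succ m ih =>
    rw [mulRightPow_succ] at hm ⊢
    have hmul : ∀ a b : FreeMagma (Fin r), (a * b).length = a.length + b.length := fun _ _ => rfl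
    obtain ⟨i, hi, hki, hspine⟩ := ih (by rw [hmul] at hm; omega)
    obtain ⟨l', hl'⟩ := (H.mul_mem_iff (mulRightPow (H.word l) (H.word k) m) (H.word k)).2
      ⟨hm, i, k, hi, rfl, hki, fun c k' hc => hspine k' (by unfold multiIndex; rw [hc]; simp)⟩
    refine ⟨l', hl', H.lt_of_length_lt _ _ ?_, fun j hj => H.multiIndex_le_last hl' hj⟩
    rw [hl', hmul]
    have := (mulRightPow (H.word l) (H.word k) m).length_pos
    omega

/-- A Hall element greater than `X_k` whose spine does not exceed `k` arises by right brackets with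
`X_k` from a Hall element whose spine is less than `k`. -/
theorem exists_eq_mulRightPow_word (k : Fin n) : ∀ {w : FreeMagma (Fin r)} {l' : Fin n},
    H.word l' = w → k < l' → (∀ j, 0 < H.multiIndex l' j → j ≤ k) →
    ∃ l m, k < l ∧ (∀ j, 0 < H.multiIndex l j → j < k) ∧
      H.word l' = mulRightPow (H.word l) (H.word k) m := by
  intro w
  induction w with
  | ih1 x =>
    intro l' hw hk _
    refine ⟨l', 0, hk, fun j hj => ?_, rfl⟩
    rw [multiIndex, hw] at hj
    exact absurd hj (lt_irrefl _)
  | ih2 a b iha _ =>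
    intro l' hw hk hspine
    obtain ⟨_, i, j, hi, hj, hji, _⟩ := H.word_eq_mul hw
    have hlast : H.word l' = a * H.word j := by rw [hw, hj]
    have hjk : j ≤ k := hspine j (by unfold multiIndex; rw [hlast]; simp)
    rcases hjk.lt_or_eq with hlt | rfl
    · exact ⟨l', 0, hk, fun p hp => (H.multiIndex_le_last hlast hp).trans_lt hlt, rfl⟩
    · obtain ⟨l, m, h1, h2, h3⟩ := iha hi hji fun p hp => hspine p <| by
        unfold multiIndex at hp ⊢
        rw [hw, spineCount_mul, ← hi]
        omega
      exact ⟨l, m + 1, h1, h2, by rw [mulRightPow_succ, ← h3, hi, hlast]⟩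

/-- A Hall element is determined by its head letter and its multi-index. -/
theorem word_eq_of_multiIndex_eq : ∀ {u : FreeMagma (Fin r)} {i j : Fin n}, H.word i = u →
    headLetter (H.word i) = headLetter (H.word j) → H.multiIndex i = H.multiIndex j → i = j := by
  have key : ∀ {w : FreeMagma (Fin r)} {l : Fin n}, H.word l = w → H.multiIndex l = 0 →
      ∃ x, w = FreeMagma.of x := by
    intro w l hw h0
    rcases w with x | ⟨a, b⟩
    · exact ⟨x, rfl⟩
    · obtain ⟨_, _, j, _, hj, _, _⟩ := H.word_eq_mul hw
      have := congrFun h0 j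
      rw [multiIndex, hw, hj] at this
      simp at this
  intro u
  induction u with
  | ih1 x =>
    intro i j hi hh hI
    have h0 : H.multiIndex i = 0 := by
      funext k
      rw [multiIndex, hi]; rfl
    obtain ⟨y, hy⟩ := key (l := j) rfl (hI ▸ h0)
    rw [hi, hy] at hh
    exact H.word_injective (by rw [hi, hy]; exact congrArg _ hh)
  | ih2 a b iha _ =>
    intro i j hi hh hI
    obtain ⟨_, i₁, j₁, hi₁, hj₁, _, _⟩ := H.word_eq_mul hi
    rcases hw : H.word j with x | ⟨c, d⟩
    · have := congrFun hI j₁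
      rw [multiIndex, multiIndex, hi, hw, ← hj₁] at this
      simp at this
    · obtain ⟨_, i₂, j₂, hi₂, hj₂, _, _⟩ := H.word_eq_mul hw
      have hi' : H.word i = a * H.word j₁ := by rw [hi, hj₁]
      have hw' : H.word j = c * H.word j₂ := by rw [hw, hj₂]; rfl
      -- The last entry of a spine is its largest one, so equal multi-indices force equal last
      -- factors.
      have hj12 : j₁ = j₂ := by
        apply le_antisymm
        · refine H.multiIndex_le_last hw' ?_
          rw [← hI, multiIndex, hi']; simp
        · refine H.multiIndex_le_last hi' ?_
          rw [hI, multiIndex, hw']; simp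
      subst hj12
      have := iha (i := i₁) (j := i₂) hi₁ (by
        rw [hi', hw'] at hh
        rwa [hi₁, hi₂]) (by
        funext k
        have := congrFun hI k
        simp only [multiIndex, hi', hw', spineCount_mul] at this
        simp only [multiIndex, hi₁, hi₂]
        omega)
      subst this
      exact H.word_injective (by rw [hi', hw', ← hi₁, hi₂])

/-- The Hall element obtained by cutting off the part of the spine that is at least `k`. -/
theorem exists_truncation (k : Fin n) : ∀ {w : FreeMagma (Fin r)} {m : Fin n}, H.word m = w →
    ∃ l, headLetter (H.word l) = headLetter (H.word m) ∧
      (∀ j < k, H.multiIndex l j = H.multiIndex m j) ∧ (∀ j, k ≤ j → H.multiIndex l j = 0) ∧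
      (l = m ∨ ∃ a, k ≤ a ∧ a < l) := by
  intro w
  induction w with
  | ih1 x =>
    intro m hm
    exact ⟨m, rfl, fun _ _ => rfl, fun j _ => by rw [multiIndex, hm]; rfl, Or.inl rfl⟩
  | ih2 a b iha _ =>
    intro m hm
    obtain ⟨_, i, j, hi, hj, hji, _⟩ := H.word_eq_mul hm
    have hm' : H.word m = a * H.word j := by rw [hm, hj]
    rcases lt_or_ge j k with hjk | hjk
    · refine ⟨m, rfl, fun _ _ => rfl, fun p hp => ?_, Or.inl rfl⟩
      by_contra h0
      exact absurd (H.multiIndex_le_last hm' (Nat.pos_of_ne_zero h0)) (not_le.2 (hjk.trans_le hp))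
    · obtain ⟨l, h1, h2, h3, h4⟩ := iha hi
      refine ⟨l, by rw [h1, hm, hi]; rfl, fun p hp => ?_, h3, Or.inr ?_⟩
      · rw [h2 p hp, multiIndex, multiIndex, hm', hi, spineCount_mul, if_neg, add_zero]
        intro h
        exact absurd (H.word_injective h) (hp.trans_le hjk).ne'
      -- If nothing more is cut off from `X_i`, the truncation is `X_i` itself and the removed
      -- factor `j < i` is the witness.
      · rcases h4 with rfl | h4
        · exact ⟨j, hjk, hji⟩
        · exact h4

end HallBasis

/-! ### The lower central series and brackets of generators -/

/-- Induction on `i` through the Jacobi identity. The `+ 1` appears because the series has the whole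
algebra at index `0`. -/
theorem lie_mem_lowerCentralSeries {R L : Type*} [CommRing R] [LieRing L] [LieAlgebra R L] (i : ℕ) :
    ∀ (j : ℕ) {x y : L}, x ∈ LieModule.lowerCentralSeries R L L i →
      y ∈ LieModule.lowerCentralSeries R L L j →
      ⁅x, y⁆ ∈ LieModule.lowerCentralSeries R L L (i + j + 1) := by
  have base : ∀ (j : ℕ) (x : L) {y : L}, y ∈ LieModule.lowerCentralSeries R L L j →
      ⁅x, y⁆ ∈ LieModule.lowerCentralSeries R L L (j + 1) := fun j x y hy => by
    rw [LieModule.lowerCentralSeries_succ]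
    exact LieSubmodule.lie_mem_lie (LieSubmodule.mem_top x) hy
  induction i with
  | zero =>
    intro j x y _ hy
    rw [zero_add]
    exact base j x hy
  | succ i ih =>
    intro j x y hx hy
    rw [LieModule.lowerCentralSeries_succ, ← LieSubmodule.mem_toSubmodule,
      LieSubmodule.lieIdeal_oper_eq_linear_span'] at hx
    induction hx using Submodule.span_induction with
    | mem x hx =>
      obtain ⟨a, _, b, hb, rfl⟩ := hx
      rw [lie_lie]
      refine sub_mem ?_ ?_
      · have := base _ a (ih j hb hy)
        rwa [show i + j + 1 + 1 = i + 1 + j + 1 by ring] at this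
      · have := ih (j + 1) hb (base j a hy)
        rwa [show i + (j + 1) + 1 = i + 1 + j + 1 by ring] at this
    | zero => simp
    | add a b _ _ ha hb => rw [add_lie]; exact add_mem ha hb
    | smul c a _ ha => rw [smul_lie]; exact SMulMemClass.smul_mem c ha

/-- The value in a Lie ring of a formal bracketing of letters. -/
def lieEval {α L : Type*} [LieRing L] (f : α → L) : FreeMagma α → L
  | .of i => f i
  | .mul a b => ⁅lieEval f a, lieEval f b⁆

section LieEval

variable {α L L' : Type*} [LieRing L] [LieRing L']

@[simp] theorem lieEval_mul (f : α → L) (a b : FreeMagma α) :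
    lieEval f (a * b) = ⁅lieEval f a, lieEval f b⁆ := rfl

theorem map_lieEval {R : Type*} [CommRing R] [LieAlgebra R L] [LieAlgebra R L'] (F : L →ₗ⁅R⁆ L')
    (f : α → L) (w : FreeMagma α) : F (lieEval f w) = lieEval (F ∘ f) w := by
  induction w with
  | ih1 i => rfl
  | ih2 a b iha ihb => rw [lieEval_mul, LieHom.map_lie, iha, ihb, lieEval_mul]

theorem lieEval_mem_lowerCentralSeries (R : Type*) [CommRing R] [LieAlgebra R L] (f : α → L)
    (w : FreeMagma α) : ∀ k < w.length, lieEval f w ∈ LieModule.lowerCentralSeries R L L k := by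
  induction w with
  | ih1 i =>
    intro k hk
    have : (FreeMagma.of i).length = 1 := rfl
    obtain rfl : k = 0 := by omega
    simp
  | ih2 a b iha ihb =>
    intro k hk
    have hmul : (a * b).length = a.length + b.length := rfl
    have ha := a.length_pos
    have hb := b.length_pos
    have := lie_mem_lowerCentralSeries (R := R) _ _ (iha (a.length - 1) (by omega))
      (ihb (b.length - 1) (by omega))
    exact LieModule.antitone_lowerCentralSeries R L L (by omega) this

end LieEval

/-- The free Lie algebra is spanned by the brackets of the generators. -/
theorem span_lieEval_freeLieAlgebra (R α : Type*) [CommRing R] :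
    Submodule.span R (range (lieEval (FreeLieAlgebra.of R : α → FreeLieAlgebra R α))) = ⊤ := by
  set e := lieEval (FreeLieAlgebra.of R : α → FreeLieAlgebra R α) with he
  let S : LieSubalgebra R (FreeLieAlgebra R α) :=
    { Submodule.span R (range e) with
      lie_mem' := by
        intro x y hx hy
        refine Submodule.span_induction₂ (p := fun x y _ _ => ⁅x, y⁆ ∈ Submodule.span R (range e))
          ?_ ?_ ?_ ?_ ?_ ?_ ?_ hx hy
        · rintro _ _ ⟨a, rfl⟩ ⟨b, rfl⟩
          exact Submodule.subset_span ⟨a * b, rfl⟩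
        · intro y _; simp
        · intro x _; simp
        · intro x y z _ _ _ h1 h2; rw [add_lie]; exact add_mem h1 h2
        · intro x y z _ _ _ h1 h2; rw [lie_add]; exact add_mem h1 h2
        · intro c x y _ _ h; rw [smul_lie]; exact Submodule.smul_mem _ c h
        · intro c x y _ _ h; rw [lie_smul]; exact Submodule.smul_mem _ c h }
  -- By the universal property, `F` followed by the inclusion of `S` is the identity, so every
  -- element lies in `S`.
  let F : FreeLieAlgebra R α →ₗ⁅R⁆ S := FreeLieAlgebra.lift R fun i =>
    ⟨FreeLieAlgebra.of R i, Submodule.subset_span ⟨FreeMagma.of i, rfl⟩⟩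
  have hF : S.incl.comp F = LieHom.id := by
    apply FreeLieAlgebra.hom_ext
    intro i
    simp [F]
  rw [eq_top_iff]
  intro x _
  have : x = S.incl (F x) := by
    rw [← LieHom.comp_apply, hF]; rfl
  rw [this]
  exact (F x).2

/-- The `k`-th term of the lower central series of the free Lie algebra is spanned by the brackets
of more than `k` generators. -/
theorem lowerCentralSeries_freeLieAlgebra_le (R α : Type*) [CommRing R] (k : ℕ) :
    (LieModule.lowerCentralSeries R (FreeLieAlgebra R α) (FreeLieAlgebra R α) k).toSubmodule ≤
      Submodule.span R (lieEval (FreeLieAlgebra.of R : α → FreeLieAlgebra R α) ''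
        {w | k < w.length}) := by
  induction k with
  | zero =>
    intro x _
    have hx : x ∈ Submodule.span R (range (lieEval (FreeLieAlgebra.of R :
        α → FreeLieAlgebra R α))) := by
      rw [span_lieEval_freeLieAlgebra]; trivial
    refine Submodule.span_mono ?_ hx
    rintro _ ⟨w, rfl⟩
    exact ⟨w, w.length_pos, rfl⟩
  | succ k ih =>
    rw [LieModule.lowerCentralSeries_succ, LieSubmodule.lieIdeal_oper_eq_linear_span',
      Submodule.span_le]
    rintro _ ⟨x, _, y, hy, rfl⟩
    have hx : x ∈ Submodule.span R (range (lieEval (FreeLieAlgebra.of R :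
        α → FreeLieAlgebra R α))) := by
      rw [span_lieEval_freeLieAlgebra]; trivial
    refine Submodule.span_induction₂ (p := fun x y _ _ => ⁅x, y⁆ ∈ Submodule.span R
      (lieEval (FreeLieAlgebra.of R : α → FreeLieAlgebra R α) '' {w | k + 1 < w.length}))
          ?_ ?_ ?_ ?_ ?_ ?_ ?_ hx (ih hy)
    · rintro _ _ ⟨a, rfl⟩ ⟨b, hb, rfl⟩
      refine Submodule.subset_span ⟨a * b, ?_, rfl⟩
      have hmul : (a * b).length = a.length + b.length := rfl
      have ha := a.length_pos
      simp only [mem_ofPred_eq] at hb ⊢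
      omega
    · intro y _; simp
    · intro x _; simp
    · intro x y z _ _ _ h1 h2; rw [add_lie]; exact add_mem h1 h2
    · intro x y z _ _ _ h1 h2; rw [lie_add]; exact add_mem h1 h2
    · intro c x y _ _ h; rw [smul_lie]; exact Submodule.smul_mem _ c h
    · intro c x y _ _ h; rw [lie_smul]; exact Submodule.smul_mem _ c h

/-! ### Hall elements span the free nilpotent Lie algebra -/

section EvalBracket

variable {r s : ℕ}

@[simp] theorem evalBracket_mul (a b : FreeMagma (Fin r)) :
    evalBracket r s (a * b) = ⁅evalBracket r s a, evalBracket r s b⁆ := rfl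

theorem evalBracket_eq_mk (w : FreeMagma (Fin r)) :
    evalBracket r s w = LieSubmodule.Quotient.mk (N := freeNilpotentIdeal r s)
      (lieEval (FreeLieAlgebra.of ℝ) w) := by
  induction w with
  | ih1 i => rfl
  | ih2 a b iha ihb =>
    rw [evalBracket_mul, iha, ihb, lieEval_mul, LieSubmodule.Quotient.mk_bracket]

theorem evalBracket_eq_zero {w : FreeMagma (Fin r)} (h : s < w.length) :
    evalBracket r s w = 0 := by
  rw [evalBracket_eq_mk]
  exact (LieSubmodule.Quotient.mk_eq_zero' (N := freeNilpotentIdeal r s)).2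
    (lieEval_mem_lowerCentralSeries ℝ _ w s h)

end EvalBracket

namespace HallBasis

variable {r s n : ℕ} (H : HallBasis r s n)

/-- The span of the Hall elements of degree `d`. -/
def degreeSpan (d : ℕ) : Submodule ℝ (FreeNilpotentLieAlgebra r s) :=
  Submodule.span ℝ (H.elt '' {l | (H.word l).length = d})

theorem elt_mem_degreeSpan (l : Fin n) : H.elt l ∈ H.degreeSpan (H.word l).length :=
  Submodule.subset_span ⟨l, rfl, rfl⟩

/-- Hall's rewriting. If `⁅X_i, X_j⁆` with `j < i` has degree at most `s` but is not a Hall element,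
then `X_i = ⁅X_h, X_k⁆` with `j < k`, and Jacobi gives `⁅X_h, ⁅X_k, X_j⁆⁆ - ⁅X_k, ⁅X_h, X_j⁆⁆`. The
inner brackets have degree less than `d` and greater than that of `X_j`, so they expand in Hall
elements after `X_j`; the outer brackets then have both entries after `X_j`. The induction is
therefore strong in `d` and, within fixed `d`, downward in `j`. -/
theorem lie_elt_mem_degreeSpan (d : ℕ) : ∀ j i, (H.word i).length + (H.word j).length = d →
    ⁅H.elt i, H.elt j⁆ ∈ H.degreeSpan d := by
  induction d using Nat.strong_induction_on with
  | _ d ihd =>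
  suffices main : ∀ j i, j < i → (H.word i).length + (H.word j).length = d →
      ⁅H.elt i, H.elt j⁆ ∈ H.degreeSpan d by
    intro j i hd
    rcases lt_trichotomy j i with h | rfl | h
    · exact main j i h hd
    · rw [lie_self]; exact zero_mem _
    · rw [← lie_skew]; exact neg_mem (main i j h (by omega))
  intro j
  induction j using WellFoundedGT.induction with
  | _ j ihj =>
  have ih : ∀ a b, j < a → j < b → (H.word a).length + (H.word b).length = d →
      ⁅H.elt a, H.elt b⁆ ∈ H.degreeSpan d := by
    intro a b ha hb hd
    rcases lt_trichotomy b a with h | rfl | h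
    · exact ihj b hb a h hd
    · rw [lie_self]; exact zero_mem _
    · rw [← lie_skew]; exact neg_mem (ihj a ha b h (by omega))
  intro i hji hd
  have hmul : (H.word i * H.word j).length = (H.word i).length + (H.word j).length := rfl
  have heval : ⁅H.elt i, H.elt j⁆ = evalBracket r s (H.word i * H.word j) := rfl
  by_cases hs : s < d
  · rw [heval, evalBracket_eq_zero (by omega)]
    exact zero_mem _
  by_cases hc : ∀ c k, H.word i = c * H.word k → k ≤ j
  · obtain ⟨l, hl⟩ := (H.mul_mem_iff (H.word i) (H.word j)).2 ⟨by omega, i, j, rfl, rfl, hji, hc⟩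
    rw [heval, ← hl]
    refine Submodule.subset_span ⟨l, ?_, rfl⟩
    rw [mem_ofPred_eq, hl, hmul, hd]
  · push Not at hc
    obtain ⟨c, k, hi, hjk⟩ := hc
    obtain ⟨_, h, k', hh, hk', hkh, _⟩ := H.word_eq_mul hi
    obtain rfl := H.word_injective hk'
    subst hh
    have hlen : (H.word i).length = (H.word h).length + (H.word k').length := by rw [hi]; rfl
    have hX : H.elt i = ⁅H.elt h, H.elt k'⁆ := by
      rw [elt, hi]; rfl
    have hhpos := (H.word h).length_pos
    have hkpos := (H.word k').length_pos
    have hgt : ∀ a, (H.word j).length < (H.word a).length → j < a := fun a =>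
      H.lt_of_length_lt j a
    rw [hX, lie_lie]
    refine sub_mem ?_ ?_
    · have h1 := ihd _ (by omega) j k' rfl
      revert h1
      generalize ⁅H.elt k', H.elt j⁆ = y
      intro hy
      induction hy using Submodule.span_induction with
      | mem y hy =>
        obtain ⟨a, ha, rfl⟩ := hy
        rw [mem_ofPred_eq] at ha
        exact ih h a (hjk.trans hkh) (hgt a (by omega)) (by omega)
      | zero => simp
      | add a b _ _ ha hb => rw [lie_add]; exact add_mem ha hb
      | smul c a _ ha => rw [lie_smul]; exact Submodule.smul_mem _ c ha
    · have h1 := ihd _ (by omega) j h rfl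
      revert h1
      generalize ⁅H.elt h, H.elt j⁆ = y
      intro hy
      induction hy using Submodule.span_induction with
      | mem y hy =>
        obtain ⟨a, ha, rfl⟩ := hy
        rw [mem_ofPred_eq] at ha
        exact ih k' a hjk (hgt a (by omega)) (by omega)
      | zero => simp
      | add a b _ _ ha hb => rw [lie_add]; exact add_mem ha hb
      | smul c a _ ha => rw [lie_smul]; exact Submodule.smul_mem _ c ha

theorem lie_mem_degreeSpan {d e : ℕ} {x y : FreeNilpotentLieAlgebra r s}
    (hx : x ∈ H.degreeSpan d) (hy : y ∈ H.degreeSpan e) : ⁅x, y⁆ ∈ H.degreeSpan (d + e) := by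
  refine Submodule.span_induction₂ (p := fun x y _ _ => ⁅x, y⁆ ∈ H.degreeSpan (d + e))
    ?_ ?_ ?_ ?_ ?_ ?_ ?_ hx hy
  · rintro _ _ ⟨a, ha, rfl⟩ ⟨b, hb, rfl⟩
    rw [mem_ofPred_eq] at ha hb
    exact H.lie_elt_mem_degreeSpan _ _ _ (by rw [ha, hb])
  · intro y _; simp
  · intro x _; simp
  · intro x y z _ _ _ h1 h2; rw [add_lie]; exact add_mem h1 h2
  · intro x y z _ _ _ h1 h2; rw [lie_add]; exact add_mem h1 h2
  · intro c x y _ _ h; rw [smul_lie]; exact Submodule.smul_mem _ c h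
  · intro c x y _ _ h; rw [lie_smul]; exact Submodule.smul_mem _ c h

theorem evalBracket_mem_degreeSpan (w : FreeMagma (Fin r)) :
    evalBracket r s w ∈ H.degreeSpan w.length := by
  induction w with
  | ih1 i =>
    have := H.elt_mem_degreeSpan (Fin.castLE H.rank_le i)
    rwa [elt, H.word_castLE] at this
  | ih2 a b iha ihb => exact H.lie_mem_degreeSpan iha ihb

theorem span_range_elt : Submodule.span ℝ (range H.elt) = ⊤ := by
  rw [eq_top_iff]
  intro x _
  obtain ⟨y, rfl⟩ := LieSubmodule.Quotient.surjective_mk' (freeNilpotentIdeal r s) x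
  have hy : y ∈ Submodule.span ℝ (range (lieEval (FreeLieAlgebra.of ℝ :
      Fin r → FreeLieAlgebra ℝ (Fin r)))) := by
    rw [span_lieEval_freeLieAlgebra]; trivial
  induction hy using Submodule.span_induction with
  | mem y hy =>
    obtain ⟨w, rfl⟩ := hy
    have h1 := H.evalBracket_mem_degreeSpan w
    rw [evalBracket_eq_mk] at h1
    exact Submodule.span_mono (image_subset_range _ _) h1
  | zero => rw [map_zero]; exact zero_mem _
  | add a b _ _ ha hb => rw [map_add]; exact add_mem (ha trivial) (hb trivial)
  | smul c a _ ha => rw [map_smul]; exact Submodule.smul_mem _ c (ha trivial)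

end HallBasis

/-! ### Linear independence of Hall elements -/

section Derivations

variable {σ : Type*}

/-- Both sides are derivations along `f`, so the variables decide. It serves for restrictions to
slices and for the dilation. -/
theorem MvPolynomial.map_derivation_eq {f : MvPolynomial σ ℝ →ₐ[ℝ] MvPolynomial σ ℝ}
    {D D' : Derivation ℝ (MvPolynomial σ ℝ) (MvPolynomial σ ℝ)}
    (h : ∀ i, f (D (MvPolynomial.X i)) = D' (f (MvPolynomial.X i))) (p : MvPolynomial σ ℝ) :
    f (D p) = D' (f p) := by
  induction p using MvPolynomial.induction_on with
  | C a =>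
    rw [← MvPolynomial.algebraMap_eq, Derivation.map_algebraMap, AlgHom.commutes,
      Derivation.map_algebraMap, map_zero]
  | add p q hp hq => simp only [map_add, hp, hq]
  | mul_X p i hp => simp only [map_mul, Derivation.leibniz, map_add, smul_eq_mul, hp, h]

/-- The iterated bracket of a derivation with a partial derivative on the right. -/
theorem MvPolynomial.iterate_lie_pderiv_X [DecidableEq σ]
    (k : σ) (m : ℕ) (D : Derivation ℝ (MvPolynomial σ ℝ) (MvPolynomial σ ℝ)) (j : σ) :
    ((fun D : Derivation ℝ (MvPolynomial σ ℝ) (MvPolynomial σ ℝ) =>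
      ⁅D, MvPolynomial.pderiv k⁆)^[m] D) (MvPolynomial.X j) =
      (fun p => -MvPolynomial.pderiv k p)^[m] (D (MvPolynomial.X j)) := by
  induction m with
  | zero => rfl
  | succ m ih =>
    rw [Function.iterate_succ_apply', Function.iterate_succ_apply', Derivation.commutator_apply, ih,
      MvPolynomial.pderiv_X]
    -- The other half of the commutator is a derivation applied to the constant `∂x_j/∂x_k`, hence
    -- zero.
    by_cases h : k = j
    · subst h; simp
    · simp [Ne.symm h]

/-- The divided power `(-x_k)^q / q!`. -/
def negDivPow (k : σ) (q : ℕ) : MvPolynomial σ ℝ :=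
  MvPolynomial.C ((q.factorial : ℝ)⁻¹) * (-MvPolynomial.X k) ^ q

@[simp] theorem negDivPow_zero (k : σ) : negDivPow k 0 = 1 := by
  simp [negDivPow]

/-- The sign in `negDivPow` makes `-∂/∂x_k` a plain shift of the exponent, which is how a right
bracket with `∂/∂x_k` acts on coefficients. -/
theorem pderiv_negDivPow_succ [DecidableEq σ] (k : σ) (q : ℕ) :
    MvPolynomial.pderiv k (negDivPow k (q + 1)) = -negDivPow k q := by
  have h : ((q + 1).factorial : ℝ)⁻¹ * (q + 1 : ℝ) = (q.factorial : ℝ)⁻¹ := by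
    rw [Nat.factorial_succ]
    have : ((q : ℝ) + 1) ≠ 0 := by positivity
    push_cast
    field_simp
  have h2 : ((q : MvPolynomial σ ℝ) + 1) = MvPolynomial.C (q + 1 : ℝ) := by simp
  unfold negDivPow
  rw [MvPolynomial.pderiv_C_mul, Derivation.leibniz_pow, map_neg, MvPolynomial.pderiv_X_self,
    ← h, MvPolynomial.C_mul]
  simp only [Nat.add_sub_cancel, smul_eq_mul, nsmul_eq_mul, Nat.cast_add, Nat.cast_one, h2]
  ring

theorem pderiv_negDivPow_of_ne [DecidableEq σ] {k i : σ} (h : i ≠ k) (q : ℕ) :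
    MvPolynomial.pderiv k (negDivPow i q) = 0 := by
  unfold negDivPow
  rw [MvPolynomial.pderiv_C_mul, Derivation.leibniz_pow, map_neg, MvPolynomial.pderiv_X_of_ne h]
  simp

theorem iterate_neg_pderiv_negDivPow [DecidableEq σ] (k : σ) (m q : ℕ) :
    (fun p => -MvPolynomial.pderiv k p)^[m] (negDivPow k q) =
      if m ≤ q then negDivPow k (q - m) else 0 := by
  induction m with
  | zero => simp
  | succ m ih =>
    rw [Function.iterate_succ_apply', ih]
    rcases lt_trichotomy m q with h | rfl | h
    · obtain ⟨p, rfl⟩ := Nat.exists_eq_add_of_lt h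
      rw [if_pos (by omega), if_pos (by omega), show m + p + 1 - m = p + 1 by omega,
        show m + p + 1 - (m + 1) = p by omega, pderiv_negDivPow_succ, neg_neg]
    · simp
    · rw [if_neg (by omega), if_neg (by omega)]; simp

theorem iterate_neg_pderiv_mul [DecidableEq σ] (k : σ) (m : ℕ) (f : MvPolynomial σ ℝ)
    {g : MvPolynomial σ ℝ} (hg : MvPolynomial.pderiv k g = 0) :
    (fun p => -MvPolynomial.pderiv k p)^[m] (f * g) =
      (fun p => -MvPolynomial.pderiv k p)^[m] f * g := by
  induction m with
  | zero => rfl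
  | succ m ih =>
    rw [Function.iterate_succ_apply', Function.iterate_succ_apply', ih, Derivation.leibniz, hg]
    simp [mul_comm]

end Derivations

/-! ### Hall elements as polynomial vector fields, and their independence. -/

namespace HallBasis

open MvPolynomial

variable {r s n : ℕ} (H : HallBasis r s n)

theorem exists_word_eq_of {l : Fin n} (h : ∀ j, H.multiIndex l j = 0) :
    ∃ x, H.word l = FreeMagma.of x := by
  rcases hw : H.word l with x | ⟨a, b⟩
  · exact ⟨x, rfl⟩
  · obtain ⟨_, _, j, _, hj, _, _⟩ := H.word_eq_mul hw
    have := h j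
    rw [multiIndex, hw, hj] at this
    simp at this

theorem length_word_aux : ∀ {w : FreeMagma (Fin r)} {l : Fin n}, H.word l = w →
    (H.word l).length = 1 + ∑ j, H.multiIndex l j * (H.word j).length := by
  intro w
  induction w with
  | ih1 x =>
    intro l hl
    simp only [multiIndex, hl, spineCount_of, zero_mul, Finset.sum_const_zero]
    rfl
  | ih2 a b iha _ =>
    intro l hl
    obtain ⟨_, i, k, hi, hk, _, _⟩ := H.word_eq_mul hl
    have hmul : (a * b).length = a.length + b.length := rfl
    have := iha hi
    simp only [multiIndex, hi] at this
    simp only [multiIndex, hl, spineCount_mul, add_mul, Finset.sum_add_distrib, ← hk,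
      H.word_injective.eq_iff]
    simp only [ite_mul, one_mul, zero_mul, Finset.sum_ite_eq, Finset.mem_univ, if_true]
    rw [hk, hmul, this]
    ring

theorem length_word (l : Fin n) :
    (H.word l).length = 1 + ∑ j, H.multiIndex l j * (H.word j).length :=
  H.length_word_aux rfl

/-- The generating vector fields as derivations of the polynomial ring. -/
def genDerivation (i : Fin r) : Derivation ℝ (MvPolynomial (Fin n) ℝ) (MvPolynomial (Fin n) ℝ) :=
  mkDerivation ℝ fun m =>
    if headLetter (H.word m) = i then ∏ j, negDivPow j (H.multiIndex m j) else 0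

/-- The part of the coefficient of `∂/∂x_m` that involves the variables `x_j` with `k ≤ j`. -/
def sliceMonomial (k : ℕ) (m : Fin n) : MvPolynomial (Fin n) ℝ :=
  ∏ j : Fin n, if (j : ℕ) < k then 1 else negDivPow j (H.multiIndex m j)

/-- The field that `X_l` induces on the slice `x_j = 0`, `j < k`, if `k ≤ l` and the spine of `X_l`
is less than `k`. -/
def sliceDerivation (k : ℕ) (l : Fin n) :
    Derivation ℝ (MvPolynomial (Fin n) ℝ) (MvPolynomial (Fin n) ℝ) :=
  mkDerivation ℝ fun m =>
    if headLetter (H.word m) = headLetter (H.word l) ∧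
      ∀ j : Fin n, (j : ℕ) < k → H.multiIndex m j = H.multiIndex l j
    then H.sliceMonomial k m else 0

/-- The restriction of polynomials to the slice `x_j = 0`, `j < k`. -/
def sliceRestrict (n k : ℕ) : MvPolynomial (Fin n) ℝ →ₐ[ℝ] MvPolynomial (Fin n) ℝ :=
  aeval fun j => if (j : ℕ) < k then 0 else X j

/-- If `X_m` has the head letter of `X_k` and the same multiplicities below `k`, its truncation at
`k` is `X_k`; a proper truncation would exceed some index `a ≥ k`, so `m = k`. The remaining
coefficient is `1` because the spine of `X_k` lies below `k`. -/
theorem sliceDerivation_self (k : Fin n) : H.sliceDerivation k k = pderiv k := by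
  apply derivation_ext
  intro m
  rw [sliceDerivation, mkDerivation_X, pderiv_X, Pi.single_apply]
  by_cases hm : m = k
  · subst hm
    rw [if_pos ⟨rfl, fun _ _ => rfl⟩, if_pos rfl]
    refine Finset.prod_eq_one fun j _ => ?_
    split_ifs with hj
    · rfl
    · have : H.multiIndex m j = 0 := by
        by_contra h0
        exact hj (H.lt_of_multiIndex_pos (Nat.pos_of_ne_zero h0))
      rw [this, negDivPow_zero]
  · rw [if_neg hm, if_neg]
    rintro ⟨hh, hI⟩
    obtain ⟨l, h1, h2, h3, h4⟩ := H.exists_truncation k (m := m) rfl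
    have hlk : l = k := by
      refine H.word_eq_of_multiIndex_eq rfl (h1.trans hh) (funext fun j => ?_)
      rcases lt_or_ge j k with hj | hj
      · rw [h2 j hj, hI j hj]
      · rw [h3 j hj]
        by_contra h0
        exact absurd (H.lt_of_multiIndex_pos (Nat.pos_of_ne_zero (Ne.symm h0))) (not_lt.2 hj)
    rcases h4 with rfl | ⟨a, h5, h6⟩
    · exact hm hlk
    · exact absurd (h5.trans_lt h6) (hlk ▸ lt_irrefl _)

theorem sliceMonomial_eq (k : Fin n) (m : Fin n) :
    H.sliceMonomial k m = negDivPow k (H.multiIndex m k) * H.sliceMonomial (k + 1) m := by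
  unfold sliceMonomial
  rw [← Finset.mul_prod_erase _ _ (Finset.mem_univ k),
    ← Finset.mul_prod_erase (a := k) _ (fun j : Fin n => if (j : ℕ) < k + 1 then
      (1 : MvPolynomial (Fin n) ℝ) else negDivPow j (H.multiIndex m j)) (Finset.mem_univ k)]
  simp only [lt_irrefl, if_false, Nat.lt_succ_self, if_true, one_mul]
  congr 1
  refine Finset.prod_congr rfl fun j hj => ?_
  have hne : (j : ℕ) ≠ k := fun h => (Finset.mem_erase.1 hj).1 (Fin.ext h)
  by_cases h : (j : ℕ) < k
  · rw [if_pos h, if_pos (by omega)]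
  · rw [if_neg h, if_neg (by omega)]

theorem pderiv_sliceMonomial (k : Fin n) (m : Fin n) :
    pderiv k (H.sliceMonomial (k + 1) m) = 0 := by
  unfold sliceMonomial
  refine Finset.prod_induction _ (fun p => pderiv k p = 0) (fun a b ha hb => ?_) ?_ fun j _ => ?_
  · rw [Derivation.leibniz, ha, hb]; simp
  · simp
  · split_ifs with h
    · simp
    · exact pderiv_negDivPow_of_ne (fun hjk => h (by rw [hjk]; omega)) _

/-- The restriction of polynomials to `x_k = 0`. -/
def killVar (k : Fin n) : MvPolynomial (Fin n) ℝ →ₐ[ℝ] MvPolynomial (Fin n) ℝ :=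
  aeval fun j => if j = k then 0 else X j

theorem killVar_sliceRestrict (k : Fin n) (p : MvPolynomial (Fin n) ℝ) :
    killVar k (sliceRestrict n k p) = sliceRestrict n (k + 1) p := by
  rw [← AlgHom.comp_apply]
  congr 1
  apply algHom_ext
  intro j
  simp only [AlgHom.comp_apply, sliceRestrict, killVar, aeval_X]
  rcases lt_trichotomy (j : ℕ) k with h | h | h
  · rw [if_pos h, if_pos (by omega), map_zero]
  · have hj : j = k := Fin.ext h
    subst hj
    simp
  · rw [if_neg (by omega), if_neg (by omega), aeval_X, if_neg (fun e => by rw [e] at h; omega)]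

theorem killVar_sliceMonomial (k : Fin n) (m : Fin n) :
    killVar k (H.sliceMonomial (k + 1) m) = H.sliceMonomial (k + 1) m := by
  unfold sliceMonomial
  rw [map_prod]
  refine Finset.prod_congr rfl fun j _ => ?_
  split_ifs with h
  · simp
  · have : j ≠ k := fun hjk => h (by rw [hjk]; omega)
    simp [negDivPow, killVar, this, ← algebraMap_eq]

theorem killVar_negDivPow (k : Fin n) (q : ℕ) :
    killVar k (negDivPow k q) = if q = 0 then 1 else 0 := by
  split_ifs with h
  · subst h; simp
  · simp [negDivPow, killVar, h]

/-- Fields tangent to the slice have tangent brackets, which can be computed on the slice; there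
`X_k` is `∂/∂x_k`. -/
theorem sliceRestrict_lieEval_mulRightPow {k : Fin n} {w : FreeMagma (Fin r)}
    {D : Derivation ℝ (MvPolynomial (Fin n) ℝ) (MvPolynomial (Fin n) ℝ)}
    (hw : ∀ p, sliceRestrict n k (lieEval H.genDerivation w p) = D (sliceRestrict n k p))
    (hk : ∀ p, sliceRestrict n k (lieEval H.genDerivation (H.word k) p) =
      pderiv k (sliceRestrict n k p)) (m : ℕ) : ∀ p,
    sliceRestrict n k (lieEval H.genDerivation (mulRightPow w (H.word k) m) p) =
      ((fun D : Derivation ℝ (MvPolynomial (Fin n) ℝ) (MvPolynomial (Fin n) ℝ) =>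
        ⁅D, pderiv k⁆)^[m] D) (sliceRestrict n k p) := by
  induction m with
  | zero => exact hw
  | succ m ih =>
    intro p
    rw [mulRightPow_succ, lieEval_mul, Function.iterate_succ_apply', Derivation.commutator_apply,
      Derivation.commutator_apply, map_sub, ih, hk, hk, ih]

/-- On the slice `x_j = 0`, `j < k`, the Hall fields `X_l` with `k ≤ l` whose spine is less than `k`
are tangent and equal to `sliceDerivation k l`. -/
theorem sliceRestrict_lieEval_word (k : ℕ) : ∀ l : Fin n, k ≤ l →
    (∀ j, 0 < H.multiIndex l j → (j : ℕ) < k) → ∀ p,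
    sliceRestrict n k (lieEval H.genDerivation (H.word l) p) =
      H.sliceDerivation k l (sliceRestrict n k p) := by
  induction k with
  | zero =>
    intro l _ hl p
    obtain ⟨x, hx⟩ := H.exists_word_eq_of (l := l) fun j => by
      by_contra h0
      exact absurd (hl j (Nat.pos_of_ne_zero h0)) (Nat.not_lt_zero _)
    have h1 : sliceRestrict n 0 = AlgHom.id ℝ _ := by
      apply algHom_ext; intro j; simp [sliceRestrict]
    have h2 : H.sliceDerivation 0 l = H.genDerivation x := by
      apply derivation_ext
      intro j
      simp [sliceDerivation, genDerivation, mkDerivation_X, hx, sliceMonomial]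
    rw [h1, h2, hx]
    rfl
  | succ k ih =>
    intro l hkl hl p
    have hkn : k < n := by omega
    -- `X_l` is `X_{l₀}` bracketed `m` times with `X_k`, and both `l₀` and `k` fall under the
    -- induction hypothesis.
    obtain ⟨l₀, m, hl₀, hspine, hword⟩ := H.exists_eq_mulRightPow_word ⟨k, hkn⟩ (l' := l) rfl
      (Fin.lt_def.2 hkl) fun j hj => Fin.le_def.2 (Nat.lt_succ_iff.1 (hl j hj))
    set κ : Fin n := ⟨k, hkn⟩ with hκ
    have hk1 : sliceRestrict n (k + 1) = (killVar κ).comp (sliceRestrict n k) := by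
      apply AlgHom.ext
      intro q
      exact (killVar_sliceRestrict κ q).symm
    have hrel := H.sliceRestrict_lieEval_mulRightPow (k := κ)
      (ih l₀ (Fin.lt_def.1 hl₀).le hspine)
      (by
        have := ih κ le_rfl fun j hj => H.lt_of_multiIndex_pos hj
        rw [H.sliceDerivation_self κ] at this
        exact this) m p
    have hI0 : H.multiIndex l₀ κ = 0 := by
      by_contra h0
      exact absurd (hspine κ (Nat.pos_of_ne_zero h0)) (lt_irrefl _)
    rw [hk1, AlgHom.comp_apply, AlgHom.comp_apply, hword, hrel]
    refine map_derivation_eq (fun j => ?_) _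
    rw [iterate_lie_pderiv_X, sliceDerivation, mkDerivation_X]
    -- Tangency to `x_κ = 0` requires the component along `∂/∂x_κ` to vanish. If it did not, head
    -- letter and multi-index would identify `l₀` with `κ`, although `κ < l₀`.
    by_cases hjk : j = κ
    · subst hjk
      rw [if_neg]
      · have h0 : (fun p => -pderiv κ p)^[m] (0 : MvPolynomial (Fin n) ℝ) = 0 :=
          Function.iterate_fixed (by simp) m
        rw [h0, map_zero, killVar, aeval_X, if_pos rfl, map_zero]
      · rintro ⟨hh, hI⟩
        refine hl₀.ne (H.word_eq_of_multiIndex_eq rfl hh (funext fun j => ?_))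
        rcases lt_or_ge j κ with hj | hj
        · exact hI j hj
        · have h1 : H.multiIndex κ j = 0 := by
            by_contra h0
            exact absurd (H.lt_of_multiIndex_pos (Nat.pos_of_ne_zero h0)) (not_lt.2 hj)
          have h2 : H.multiIndex l₀ j = 0 := by
            by_contra h0
            exact absurd (hspine j (Nat.pos_of_ne_zero h0)) (not_lt.2 (Fin.le_def.1 hj))
          rw [h1, h2]
    · have hX : killVar κ (X j) = X j := by simp [killVar, hjk]
      have hcond : (headLetter (H.word j) = headLetter (H.word l) ∧
          ∀ i : Fin n, (i : ℕ) < k + 1 → H.multiIndex j i = H.multiIndex l i) ↔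
          (headLetter (H.word j) = headLetter (H.word l₀) ∧
          ∀ i : Fin n, (i : ℕ) < k → H.multiIndex j i = H.multiIndex l₀ i) ∧
          H.multiIndex j κ = m := by
        rw [hword, headLetter_mulRightPow, and_assoc]
        refine and_congr_right fun _ => ⟨fun h => ⟨fun i hi => ?_, ?_⟩, fun ⟨h, h'⟩ i hi => ?_⟩
        · rw [h i (by omega), H.multiIndex_of_eq_mulRightPow hword, if_neg, add_zero]
          rintro rfl
          exact lt_irrefl _ hi
        · rw [h κ (Nat.lt_succ_self k), H.multiIndex_of_eq_mulRightPow hword, hI0]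
          simp
        · rw [H.multiIndex_of_eq_mulRightPow hword]
          by_cases hik : κ = i
          · subst hik; simp [hI0, h']
          · rw [if_neg hik, add_zero]
            refine h i ?_
            have : (i : ℕ) ≠ k := fun h => hik (Fin.ext h.symm)
            omega
      rw [hX, sliceDerivation, mkDerivation_X]
      by_cases hc : headLetter (H.word j) = headLetter (H.word l₀) ∧
          ∀ i : Fin n, (i : ℕ) < k → H.multiIndex j i = H.multiIndex l₀ i
      · have hcc : (headLetter (H.word j) = headLetter (H.word l) ∧
          ∀ i : Fin n, (i : ℕ) < k + 1 → H.multiIndex j i = H.multiIndex l i) ↔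
            H.multiIndex j κ = m := by rw [hcond]; exact and_iff_right hc
        have hS : H.sliceMonomial k j =
            negDivPow κ (H.multiIndex j κ) * H.sliceMonomial (k + 1) j := H.sliceMonomial_eq κ j
        rw [if_pos hc, hS, iterate_neg_pderiv_mul _ _ _ (H.pderiv_sliceMonomial κ j), map_mul,
          iterate_neg_pderiv_negDivPow]
        have hkS : killVar κ (H.sliceMonomial (k + 1) j) = H.sliceMonomial (k + 1) j :=
          H.killVar_sliceMonomial κ j
        rw [hkS]
        -- After `m` applications of `-∂/∂x_κ`, setting `x_κ = 0` keeps only the monomials whose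
        -- exponent in `x_κ` was exactly `m`.
        by_cases hm : H.multiIndex j κ = m
        · rw [if_pos (hcc.2 hm), if_pos hm.ge, killVar_negDivPow, if_pos (by omega), one_mul]
        · rw [if_neg (fun h => hm (hcc.1 h))]
          split_ifs with h
          · rw [killVar_negDivPow, if_neg (by omega), zero_mul]
          · rw [map_zero, zero_mul]
      · rw [if_neg hc, if_neg (fun h => hc (hcond.1 h).1)]
        have h0 : (fun p => -pderiv κ p)^[m] (0 : MvPolynomial (Fin n) ℝ) = 0 :=
          Function.iterate_fixed (by simp) m
        rw [h0, map_zero]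

theorem constantCoeff_sliceRestrict (k : ℕ) (p : MvPolynomial (Fin n) ℝ) :
    constantCoeff (sliceRestrict n k p) = constantCoeff p := by
  induction p using MvPolynomial.induction_on with
  | C a => simp [sliceRestrict]
  | add p q hp hq => simp only [map_add, hp, hq]
  | mul_X p i hp =>
    simp only [map_mul, sliceRestrict, aeval_X]
    split_ifs <;> simp

/-- At the origin the Hall field `X_l` is `∂/∂x_l`. -/
theorem constantCoeff_lieEval_word (l m : Fin n) :
    constantCoeff (lieEval H.genDerivation (H.word l) (X m)) = if l = m then 1 else 0 := by
  -- The slice with `k = l` contains the origin, and the field restricts to `∂/∂x_l` on it.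
  rw [← constantCoeff_sliceRestrict l, H.sliceRestrict_lieEval_word l l le_rfl
    fun j hj => H.lt_of_multiIndex_pos hj, sliceDerivation_self, sliceRestrict, aeval_X]
  split_ifs with h1 h2 h2
  · subst h2; exact absurd h1 (lt_irrefl _)
  · simp
  · subst h2; simp
  · simp [pderiv_X, Ne.symm h2]

/-- The dilation of factor `2`. -/
def dilation : MvPolynomial (Fin n) ℝ →ₐ[ℝ] MvPolynomial (Fin n) ℝ :=
  aeval fun j => C (2 ^ (H.word j).length) * X j

/-- By `length_word` the coefficient of `∂/∂x_m` has weight one less than `x_m`, so the generators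
are homogeneous of degree one. -/
theorem genDerivation_dilation (i : Fin r) (p : MvPolynomial (Fin n) ℝ) :
    H.genDerivation i (H.dilation p) = (2 : ℝ) • H.dilation (H.genDerivation i p) := by
  have hD : ∀ (q : MvPolynomial (Fin n) ℝ), ((2 : ℝ)⁻¹ • H.genDerivation i) q =
      (2 : ℝ)⁻¹ • H.genDerivation i q := fun _ => rfl
  have key := map_derivation_eq (f := H.dilation) (D := H.genDerivation i)
    (D' := (2 : ℝ)⁻¹ • H.genDerivation i) (fun m => ?_) p
  · rw [key, hD, smul_smul]; norm_num
  · rw [hD, dilation, aeval_X, Derivation.leibniz, genDerivation, mkDerivation_X]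
    have hC : mkDerivation ℝ (fun m => if headLetter (H.word m) = i then
        ∏ j, negDivPow j (H.multiIndex m j) else 0) (C (2 ^ (H.word m).length)) = 0 := by
      rw [← algebraMap_eq, Derivation.map_algebraMap]
    rw [hC, smul_zero, add_zero]
    split_ifs with h
    · rw [map_prod]
      have hj : ∀ j : Fin n, (aeval fun j => C ((2 : ℝ) ^ (H.word j).length) * X j)
          (negDivPow j (H.multiIndex m j)) =
          C (2 ^ (H.multiIndex m j * (H.word j).length)) * negDivPow j (H.multiIndex m j) := by
        intro j
        simp only [negDivPow, map_mul, map_pow, map_neg, aeval_X, ← algebraMap_eq,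
          AlgHom.commutes]
        rw [← mul_neg, mul_pow, ← pow_mul, mul_comm (H.word j).length]
        ring
      simp only [hj, Finset.prod_mul_distrib]
      rw [← map_prod, Finset.prod_pow_eq_pow_sum, H.length_word m, pow_add, smul_eq_mul,
        MvPolynomial.smul_eq_C_mul, ← mul_assoc, ← C_mul, pow_one, inv_mul_cancel_left₀ two_ne_zero,
        mul_comm]
    · simp

theorem lieEval_dilation (w : FreeMagma (Fin r)) : ∀ p : MvPolynomial (Fin n) ℝ,
    lieEval H.genDerivation w (H.dilation p) =
      (2 : ℝ) ^ w.length • H.dilation (lieEval H.genDerivation w p) := by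
  induction w with
  | ih1 i =>
    intro p
    have : (FreeMagma.of i).length = 1 := rfl
    rw [this, pow_one]
    exact H.genDerivation_dilation i p
  | ih2 a b iha ihb =>
    intro p
    have hmul : (a * b).length = a.length + b.length := rfl
    rw [lieEval_mul, Derivation.commutator_apply, Derivation.commutator_apply, iha p, ihb p,
      Derivation.map_smul, Derivation.map_smul, iha, ihb, map_sub, smul_sub, smul_smul, smul_smul,
      hmul, pow_add]
    rw [mul_comm ((2 : ℝ) ^ b.length)]

/-- Homogeneity scales the constant term `c` by the degree of `w` on one side and by that of `X_m`
on the other. Distinct powers of `2` force `c = 0`. -/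
theorem constantCoeff_lieEval_eq_zero {w : FreeMagma (Fin r)} {m : Fin n}
    (h : w.length ≠ (H.word m).length) :
    constantCoeff (lieEval H.genDerivation w (X m)) = 0 := by
  have h1 := congrArg constantCoeff (H.lieEval_dilation w (X m))
  have h2 : ∀ p, constantCoeff (H.dilation p) = constantCoeff p := by
    intro p
    induction p using MvPolynomial.induction_on with
    | C a => simp [dilation]
    | add p q hp hq => simp only [map_add, hp, hq]
    | mul_X p i hp => simp [dilation]
  rw [constantCoeff_smul, h2] at h1
  rw [dilation, aeval_X, ← smul_eq_C_mul, Derivation.map_smul, constantCoeff_smul, smul_eq_mul,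
    smul_eq_mul] at h1
  by_contra h0
  have h3 := mul_right_cancel₀ h0 h1
  exact h (Nat.pow_right_injective (le_refl 2) (by exact_mod_cast h3)).symm

/-- The functional `ψ` takes the component along `∂/∂x_m` at the origin. It is defined on the free
Lie algebra and kills the ideal of the quotient, which is spanned by brackets of more than `s`
letters, while `X_m` has at most `s`. On the Hall elements it is the `m`-th dual coordinate. -/
theorem linearIndependent_elt (hs : 1 ≤ s) : LinearIndependent ℝ H.elt := by
  let φ := FreeLieAlgebra.lift ℝ H.genDerivation
  have hφ : ∀ w, φ (lieEval (FreeLieAlgebra.of ℝ) w) = lieEval H.genDerivation w := fun w => by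
    rw [map_lieEval, FreeLieAlgebra.of_comp_lift]
  rw [Fintype.linearIndependent_iff]
  intro c hc m
  let ψ : FreeLieAlgebra ℝ (Fin r) →ₗ[ℝ] ℝ :=
    { toFun := fun y => constantCoeff (φ y (X m))
      map_add' := fun x y => by simp
      map_smul' := fun a x => by simp }
  have hψ : ∀ w, ψ (lieEval (FreeLieAlgebra.of ℝ) w) =
      constantCoeff (lieEval H.genDerivation w (X m)) := fun w => by
    rw [← hφ]; rfl
  have hmem : ∑ l, c l • lieEval (FreeLieAlgebra.of ℝ) (H.word l) ∈ freeNilpotentIdeal r s := by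
    rw [← LieSubmodule.Quotient.mk_eq_zero']
    have : (LieSubmodule.Quotient.mk' (freeNilpotentIdeal r s))
        (∑ l, c l • lieEval (FreeLieAlgebra.of ℝ) (H.word l)) = 0 := by
      rw [map_sum, ← hc]
      refine Finset.sum_congr rfl fun l _ => ?_
      rw [map_smul, elt, evalBracket_eq_mk]
      rfl
    exact this
  have hker : ∑ l, c l • lieEval (FreeLieAlgebra.of ℝ) (H.word l) ∈ LinearMap.ker ψ := by
    refine Submodule.span_le.2 ?_ (lowerCentralSeries_freeLieAlgebra_le ℝ (Fin r) s hmem)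
    rintro _ ⟨w, hw, rfl⟩
    rw [mem_ofPred_eq] at hw
    have := H.length_word_le hs m
    exact LinearMap.mem_ker.2
      ((hψ w).trans (H.constantCoeff_lieEval_eq_zero (by omega)))
  rw [LinearMap.mem_ker, map_sum] at hker
  simpa [hψ, H.constantCoeff_lieEval_word] using hker

/-- The Hall elements as a basis of the free nilpotent Lie algebra. -/
def basis (hs : 1 ≤ s) : Module.Basis (Fin n) ℝ (FreeNilpotentLieAlgebra r s) :=
  Module.Basis.mk (H.linearIndependent_elt hs) H.span_range_elt.ge

@[simp] theorem basis_apply (hs : 1 ≤ s) (l : Fin n) : H.basis hs l = H.elt l := by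
  simp [basis]

theorem coords_eq_repr (hs : 1 ≤ s) (y : FreeNilpotentLieAlgebra r s) (k : Fin n) :
    H.coords y k = (H.basis hs).repr y k := by
  have h : y = ∑ k, H.coords y k • H.elt k :=
    Classical.epsilon_spec (p := fun c : Fin n → ℝ => y = ∑ k, c k • H.elt k)
      ⟨fun k => (H.basis hs).repr y k, by simpa using ((H.basis hs).sum_repr y).symm⟩
  conv_rhs => rw [h]
  simp only [← H.basis_apply hs]
  rw [Module.Basis.repr_sum_self]

end HallBasis

/-! ### Exponentials of inner derivations -/

theorem lowerCentralSeries_freeNilpotent (r s : ℕ) :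
    LieModule.lowerCentralSeries ℝ (FreeNilpotentLieAlgebra r s) (FreeNilpotentLieAlgebra r s) s =
      ⊥ := by
  rw [eq_bot_iff]
  intro x hx
  have hsurj : Function.Surjective (LieSubmodule.Quotient.mk' (freeNilpotentIdeal r s)) :=
    LieSubmodule.Quotient.surjective_mk' _
  have hker : ∀ k, ∀ y ∈ LieModule.lowerCentralSeries ℝ (FreeNilpotentLieAlgebra r s)
      (FreeNilpotentLieAlgebra r s) k, ∃ z ∈ LieModule.lowerCentralSeries ℝ
        (FreeLieAlgebra ℝ (Fin r)) (FreeLieAlgebra ℝ (Fin r)) k,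
        LieSubmodule.Quotient.mk' (freeNilpotentIdeal r s) z = y := by
    intro k
    induction k with
    | zero =>
      intro y _
      obtain ⟨z, hz⟩ := hsurj y
      exact ⟨z, trivial, hz⟩
    | succ k ih =>
      intro y hy
      rw [LieModule.lowerCentralSeries_succ, ← LieSubmodule.mem_toSubmodule,
        LieSubmodule.lieIdeal_oper_eq_linear_span'] at hy
      induction hy using Submodule.span_induction with
      | mem y hy =>
        obtain ⟨a, _, b, hb, rfl⟩ := hy
        obtain ⟨a', rfl⟩ := hsurj a
        obtain ⟨b', hb', rfl⟩ := ih b hb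
        refine ⟨⁅a', b'⁆, ?_, rfl⟩
        rw [LieModule.lowerCentralSeries_succ]
        exact LieSubmodule.lie_mem_lie (LieSubmodule.mem_top _) hb'
      | zero => exact ⟨0, zero_mem _, map_zero _⟩
      | add a b _ _ ha hb =>
        obtain ⟨a', h1, rfl⟩ := ha
        obtain ⟨b', h2, rfl⟩ := hb
        exact ⟨a' + b', add_mem h1 h2, map_add _ _ _⟩
      | smul c a _ ha =>
        obtain ⟨a', h1, rfl⟩ := ha
        exact ⟨c • a', SMulMemClass.smul_mem c h1, map_smul _ _ _⟩
  obtain ⟨z, hz, rfl⟩ := hker s x hx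
  exact (LieSubmodule.Quotient.mk_eq_zero' (N := freeNilpotentIdeal r s)).2 hz

theorem ad_pow_eq_zero {r s : ℕ} (x : FreeNilpotentLieAlgebra r s) {m : ℕ} (hm : s ≤ m) :
    (LieAlgebra.ad ℝ (FreeNilpotentLieAlgebra r s) x) ^ m = 0 := by
  apply LinearMap.ext
  intro y
  have h1 := LieModule.iterate_toEnd_mem_lowerCentralSeries ℝ (FreeNilpotentLieAlgebra r s)
    (FreeNilpotentLieAlgebra r s) x y m
  have h2 := LieModule.antitone_lowerCentralSeries ℝ (FreeNilpotentLieAlgebra r s)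
    (FreeNilpotentLieAlgebra r s) hm h1
  rw [lowerCentralSeries_freeNilpotent, LieSubmodule.mem_bot] at h2
  rw [Module.End.pow_apply]
  exact h2

/-- The automorphism `exp (t ad x)` of the free nilpotent Lie algebra. -/
def expAd {r s : ℕ} (x : FreeNilpotentLieAlgebra r s) (t : ℝ) :
    Module.End ℝ (FreeNilpotentLieAlgebra r s) :=
  ∑ m ∈ Finset.range (s + 1), (t ^ m / m.factorial) •
    (LieAlgebra.ad ℝ (FreeNilpotentLieAlgebra r s) x) ^ m

section ExpAd

variable {r s : ℕ} (x : FreeNilpotentLieAlgebra r s) (t : ℝ)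

theorem expAd_apply (y : FreeNilpotentLieAlgebra r s) :
    expAd x t y = ∑ m ∈ Finset.range (s + 1), (t ^ m / m.factorial) •
      ((LieAlgebra.ad ℝ (FreeNilpotentLieAlgebra r s) x) ^ m) y := by
  simp [expAd, LinearMap.sum_apply]

/-- The exponential of a nilpotent derivation is an automorphism. The rational structure needed by
`IsNilpotent.exp` comes from restriction of scalars. -/
theorem expAd_lie (y z : FreeNilpotentLieAlgebra r s) :
    expAd x t ⁅y, z⁆ = ⁅expAd x t y, expAd x t z⁆ := by
  let D : LieDerivation ℝ (FreeNilpotentLieAlgebra r s) (FreeNilpotentLieAlgebra r s) :=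
    t • LieDerivation.ad ℝ (FreeNilpotentLieAlgebra r s) x
  let : Module ℚ (FreeNilpotentLieAlgebra r s) :=
    Module.compHom (FreeNilpotentLieAlgebra r s) (algebraMap ℚ ℝ)
  let : LieAlgebra ℚ (FreeNilpotentLieAlgebra r s) :=
    { lie_smul := fun c y z => lie_smul (c : ℝ) y z }
  have hD : D.toLinearMap = t • LieAlgebra.ad ℝ (FreeNilpotentLieAlgebra r s) x := by
    apply LinearMap.ext
    intro y
    simp [D]
  have h0 : D.toLinearMap ^ (s + 1) = 0 := by
    rw [hD, smul_pow, ad_pow_eq_zero _ (Nat.le_succ s), smul_zero]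
  have hnil : IsNilpotent D.toLinearMap := ⟨_, h0⟩
  have hexp : IsNilpotent.exp D.toLinearMap = expAd x t := by
    rw [IsNilpotent.exp_eq_sum h0, expAd]
    refine Finset.sum_congr rfl fun m _ => ?_
    rw [hD, smul_pow, ← Rat.cast_smul_eq_qsmul ℝ, smul_smul]
    push_cast
    rw [mul_comm, div_eq_mul_inv]
  have h : ∀ y, LieDerivation.exp D hnil y = expAd x t y := fun y => by
    rw [LieDerivation.exp_map_apply, hexp]
  rw [← h, ← h, ← h, LieEquiv.map_lie]

theorem expAd_self : expAd x t x = x := by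
  rw [expAd_apply, Finset.sum_range_succ']
  simp [pow_succ]

theorem hasDerivAt_expAd (v : FreeNilpotentLieAlgebra r s →ₗ[ℝ] ℝ)
    (y : FreeNilpotentLieAlgebra r s) :
    HasDerivAt (fun t => v (expAd x t y)) (v ⁅x, expAd x t y⁆) t := by
  have h1 : ∀ m ∈ Finset.range (s + 1), HasDerivAt
      (fun t : ℝ => t ^ m / m.factorial *
        v (((LieAlgebra.ad ℝ (FreeNilpotentLieAlgebra r s) x) ^ m) y))
      ((m * t ^ (m - 1)) / m.factorial *
        v (((LieAlgebra.ad ℝ (FreeNilpotentLieAlgebra r s) x) ^ m) y)) t := fun m _ =>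
    ((hasDerivAt_pow m t).div_const _).mul_const _
  have h2 := HasDerivAt.fun_sum h1
  have h3 : (fun t => v (expAd x t y)) = fun t => ∑ m ∈ Finset.range (s + 1),
      (t ^ m / m.factorial * v (((LieAlgebra.ad ℝ (FreeNilpotentLieAlgebra r s) x) ^ m) y)) := by
    funext t
    rw [expAd_apply, map_sum]
    simp
  rw [h3]
  refine h2.congr_deriv ?_
  symm
  rw [Finset.sum_range_succ', expAd_apply, lie_sum, map_sum, Finset.sum_range_succ]
  -- Differentiation shifts the index by one; the unmatched term of order `s` is zero by nilpotency.
  have hs : ⁅x, (t ^ s / (s.factorial : ℝ)) •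
      ((LieAlgebra.ad ℝ (FreeNilpotentLieAlgebra r s) x) ^ s) y⁆ = 0 := by
    rw [ad_pow_eq_zero x le_rfl]; simp
  rw [hs]
  simp only [map_zero, add_zero, Nat.cast_zero, zero_mul, zero_div]
  refine Finset.sum_congr rfl fun m _ => ?_
  rw [lie_smul, map_smul, smul_eq_mul, pow_succ', Module.End.mul_apply, LieAlgebra.ad_apply,
    Nat.factorial_succ, Nat.add_sub_cancel]
  have : ((m : ℝ) + 1) ≠ 0 := by positivity
  push_cast
  field_simp

end ExpAd

/-! ### Products of exponentials and the Maurer-Cartan form. -/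

namespace HallBasis

variable {r s n : ℕ} (H : HallBasis r s n)

/-- The product of the automorphisms `exp (x_j ad X_j)` over a list of indices; the first entry
of the list acts first. -/
def expList (x : Fin n → ℝ) : List (Fin n) → Module.End ℝ (FreeNilpotentLieAlgebra r s)
  | [] => 1
  | j :: L => expList x L * expAd (H.elt j) (x j)

@[simp] theorem expList_cons (x : Fin n → ℝ) (j : Fin n) (L : List (Fin n))
    (y : FreeNilpotentLieAlgebra r s) :
    H.expList x (j :: L) y = H.expList x L (expAd (H.elt j) (x j) y) := rfl

theorem expList_append (x : Fin n → ℝ) (L L' : List (Fin n)) (y : FreeNilpotentLieAlgebra r s) :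
    H.expList x (L ++ L') y = H.expList x L' (H.expList x L y) := by
  induction L generalizing y with
  | nil => rfl
  | cons j L ih => simp [ih]

theorem expList_lie (x : Fin n → ℝ) (L : List (Fin n)) (y z : FreeNilpotentLieAlgebra r s) :
    H.expList x L ⁅y, z⁆ = ⁅H.expList x L y, H.expList x L z⁆ := by
  induction L generalizing y z with
  | nil => rfl
  | cons j L ih => rw [expList_cons, expAd_lie, ih]; rfl

theorem expList_update_of_notMem (x : Fin n → ℝ) {L : List (Fin n)} {l : Fin n} (hl : l ∉ L)
    (t : ℝ) (y : FreeNilpotentLieAlgebra r s) :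
    H.expList (Function.update x l t) L y = H.expList x L y := by
  induction L generalizing y with
  | nil => rfl
  | cons j L ih =>
    rw [List.mem_cons, not_or] at hl
    rw [expList_cons, expList_cons, ih hl.2, Function.update_of_ne (Ne.symm hl.1)]

theorem contDiff_expList (v : FreeNilpotentLieAlgebra r s →ₗ[ℝ] ℝ) (L : List (Fin n))
    (y : FreeNilpotentLieAlgebra r s) : ContDiff ℝ 1 fun x => v (H.expList x L y) := by
  induction L generalizing y with
  | nil => exact (contDiff_const : ContDiff ℝ 1 fun _ : Fin n → ℝ => v y)
  | cons j L ih =>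
    simp only [expList_cons, expAd_apply, map_sum, map_smul, smul_eq_mul]
    refine ContDiff.sum fun m _ =>
      ContDiff.mul (f := fun x : Fin n → ℝ => x j ^ m / (m.factorial : ℝ)) ?_ (ih _)
    fun_prop

/-- The automorphism `exp (x_{n-1} ad X_{n-1}) ⋯ exp (x_k ad X_k)`. -/
def expSuffix (x : Fin n → ℝ) (k : ℕ) : Module.End ℝ (FreeNilpotentLieAlgebra r s) :=
  H.expList x ((List.finRange n).drop k)

theorem drop_finRange (k : Fin n) :
    (List.finRange n).drop k = k :: (List.finRange n).drop (k + 1) := by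
  rw [List.drop_eq_getElem_cons (by simp)]
  simp

theorem expSuffix_apply (x : Fin n → ℝ) (k : Fin n) (y : FreeNilpotentLieAlgebra r s) :
    H.expSuffix x k y = H.expSuffix x (k + 1) (expAd (H.elt k) (x k) y) := by
  rw [expSuffix, drop_finRange]
  rfl

/-- The `l`-th component of the right-invariant Maurer-Cartan form. -/
def maurerCartan (x : Fin n → ℝ) (l : Fin n) : FreeNilpotentLieAlgebra r s :=
  H.expSuffix x (l + 1) (H.elt l)

theorem mem_drop_finRange {k : ℕ} {l : Fin n} : l ∈ (List.finRange n).drop k ↔ k ≤ l := by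
  rw [List.mem_drop_iff_getElem]
  constructor
  · rintro ⟨i, hi, h⟩
    rw [← h]
    simp
  · intro h
    exact ⟨l - k, by simp; omega, by apply Fin.ext; simp; omega⟩

/-- Only the factor `exp (x_l ad X_l)` depends on `x_l`. Its derivative brings down `ad X_l`, and
the factors applied afterwards, being automorphisms, turn `X_l` into `maurerCartan x l`. This is the
Maurer-Cartan equation in coordinates. -/
theorem fderiv_expSuffix (v : FreeNilpotentLieAlgebra r s →ₗ[ℝ] ℝ) (k : ℕ)
    (y : FreeNilpotentLieAlgebra r s) (x : Fin n → ℝ) (l : Fin n) :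
    fderiv ℝ (fun x => v (H.expSuffix x k y)) x (Pi.single l 1) =
      if k ≤ l then v ⁅H.maurerCartan x l, H.expSuffix x k y⁆ else 0 := by
  have hdiff : DifferentiableAt ℝ (fun x => v (H.expSuffix x k y)) x :=
    (H.contDiff_expList v _ y).differentiable one_ne_zero x
  have hd : HasDerivAt (fun t => v (H.expSuffix (Function.update x l t) k y))
      (fderiv ℝ (fun x => v (H.expSuffix x k y)) x (Pi.single l 1)) (x l) := by
    have h1 := hasDerivAt_update x l (x l)
    have h2 : HasFDerivAt (fun x => v (H.expSuffix x k y))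
      (fderiv ℝ (fun x => v (H.expSuffix x k y)) x) (Function.update x l (x l)) := by
      rw [Function.update_eq_self]; exact hdiff.hasFDerivAt
    exact h2.comp_hasDerivAt _ h1
  refine hd.unique ?_
  split_ifs with hkl
  · have hsplit : (List.finRange n).drop k = ((List.finRange n).drop k).take (l - k) ++
        l :: (List.finRange n).drop (l + 1) := by
      rw [← drop_finRange]
      conv_lhs => rw [← List.take_append_drop (l - k) ((List.finRange n).drop k)]
      rw [List.drop_drop, Nat.add_sub_cancel' hkl]
    have hnd : ((List.finRange n).drop k).Nodup := (List.nodup_finRange n).drop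
    have hd1 : l ∉ ((List.finRange n).drop k).take (l - k) := by
      rw [hsplit, List.nodup_append] at hnd
      intro hmem
      exact hnd.2.2 l hmem l List.mem_cons_self rfl
    have hd2 : l ∉ (List.finRange n).drop (l + 1) := by
      rw [mem_drop_finRange]; omega
    have hfun : ∀ t, H.expSuffix (Function.update x l t) k y =
        H.expSuffix x (l + 1) (expAd (H.elt l) t
          (H.expList x (((List.finRange n).drop k).take (l - k)) y)) := by
      intro t
      conv_lhs => rw [expSuffix, hsplit]
      rw [expList_append, expList_cons, expList_update_of_notMem _ _ hd2,
        expList_update_of_notMem _ _ hd1, Function.update_self]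
      rfl
    have hval := hfun (x l)
    rw [Function.update_eq_self] at hval
    simp only [hfun]
    have := hasDerivAt_expAd (H.elt l) (x l) (v ∘ₗ H.expSuffix x (l + 1))
      (H.expList x (((List.finRange n).drop k).take (l - k)) y)
    have hlie : H.expSuffix x (l + 1) ⁅H.elt l, expAd (H.elt l) (x l)
          (H.expList x (((List.finRange n).drop k).take (l - k)) y)⁆ =
        ⁅H.maurerCartan x l, H.expSuffix x k y⁆ := by
      rw [hval]
      exact H.expList_lie _ _ _ _
    rw [← hlie]
    exact this
  · have hl : l ∉ (List.finRange n).drop k := by rwa [mem_drop_finRange]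
    have : ∀ t, H.expSuffix (Function.update x l t) k y = H.expSuffix x k y := fun t =>
      H.expList_update_of_notMem x hl t y
    simp only [this]
    exact hasDerivAt_const _ _

/-! ### The vector fields in exponential coordinates -/

/-- The coefficient `∏ j, (-x_j)^I(l)_j / I(l)_j!`. -/
def coef (x : Fin n → ℝ) (l : Fin n) : ℝ :=
  ∏ j, (-x j) ^ H.multiIndex l j / (H.multiIndex l j).factorial

theorem prod_neg_pow_div (x : Fin n → ℝ) (α : Fin n → ℕ) :
    ∏ j, (-x j) ^ α j / ((α j).factorial : ℝ) =
      (-1) ^ (∑ j, α j) / (∏ j, ((α j).factorial : ℝ)) * ∏ j, x j ^ α j := by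
  have : ∀ j, (-x j) ^ α j = (-1) ^ α j * x j ^ α j := fun j => by rw [neg_pow]
  simp only [this]
  rw [Finset.prod_div_distrib, Finset.prod_mul_distrib, Finset.prod_pow_eq_pow_sum]
  ring

theorem vectorField_apply (i : Fin r) (x : Fin n → ℝ) (l : Fin n) :
    H.vectorField i x l = if headLetter (H.word l) = i then H.coef x l else 0 := by
  rw [vectorField, coef, prod_neg_pow_div]

theorem coef_of_eq_mulRightPow (x : Fin n → ℝ) {l l' k : Fin n} {m : ℕ}
    (h : H.word l' = mulRightPow (H.word l) (H.word k) m) (h0 : H.multiIndex l k = 0) :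
    H.coef x l' = H.coef x l * ((-x k) ^ m / m.factorial) := by
  unfold coef
  rw [← Finset.mul_prod_erase _ _ (Finset.mem_univ k),
    ← Finset.mul_prod_erase (a := k) _ (fun j => (-x j) ^ H.multiIndex l j /
      ((H.multiIndex l j).factorial : ℝ)) (Finset.mem_univ k)]
  have h1 : H.multiIndex l' k = m := by
    rw [H.multiIndex_of_eq_mulRightPow h, h0]; simp
  have h2 : ∏ j ∈ Finset.univ.erase k, (-x j) ^ H.multiIndex l' j /
      ((H.multiIndex l' j).factorial : ℝ) = ∏ j ∈ Finset.univ.erase k,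
        (-x j) ^ H.multiIndex l j / ((H.multiIndex l j).factorial : ℝ) := by
    refine Finset.prod_congr rfl fun j hj => ?_
    rw [H.multiIndex_of_eq_mulRightPow h, if_neg (Finset.ne_of_mem_erase hj).symm, add_zero]
  rw [h1, h2, h0]
  simp
  ring

theorem ad_pow_elt (k l : Fin n) (m : ℕ) :
    ((LieAlgebra.ad ℝ (FreeNilpotentLieAlgebra r s) (H.elt k)) ^ m) (H.elt l) =
      (-1 : ℝ) ^ m • evalBracket r s (mulRightPow (H.word l) (H.word k) m) := by
  induction m with
  | zero => simp [elt]
  | succ m ih =>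
    rw [pow_succ', Module.End.mul_apply, ih, map_smul, LieAlgebra.ad_apply, mulRightPow_succ,
      evalBracket_mul, ← lie_skew, pow_succ, mul_smul, neg_one_smul]
    rfl

open Classical in
/-- The Hall elements `X_l` with `k ≤ l` and head letter `i` whose spine is less than `k`. -/
def layer (i : Fin r) (k : ℕ) : Finset (Fin n) :=
  {l | k ≤ (l : ℕ) ∧ (∀ j, 0 < H.multiIndex l j → (j : ℕ) < k) ∧ headLetter (H.word l) = i}

theorem mem_layer {i : Fin r} {k : ℕ} {l : Fin n} : l ∈ H.layer i k ↔
    k ≤ (l : ℕ) ∧ (∀ j, 0 < H.multiIndex l j → (j : ℕ) < k) ∧ headLetter (H.word l) = i := by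
  simp [layer]

theorem mulRightPow_injective {a a' b : FreeMagma (Fin r)} {m : ℕ}
    (h : mulRightPow a b m = mulRightPow a' b m) : a = a' := by
  induction m with
  | zero => exact h
  | succ m ih =>
    rw [mulRightPow_succ, mulRightPow_succ] at h
    exact ih (by injection h)

/-- The series produces the words `mulRightPow X_l X_k m` with coefficient `coef x l * (-x_k)^m /
m!`. Each has degree beyond `s` and vanishes, or is a Hall element of the next layer, and every
element of that layer arises exactly once. `X_k` is left out because the exponential fixes it. -/
theorem expAd_sum_layer (x : Fin n → ℝ) (i : Fin r) (k : Fin n) :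
    expAd (H.elt k) (x k) (∑ l ∈ (H.layer i k).erase k, H.coef x l • H.elt l) =
      ∑ l ∈ H.layer i (k + 1), H.coef x l • H.elt l := by
  have hzero : ∀ l ∈ (H.layer i k).erase k, H.multiIndex l k = 0 := by
    intro l hl
    by_contra h0
    exact absurd ((H.mem_layer.1 (Finset.mem_of_mem_erase hl)).2.1 k (Nat.pos_of_ne_zero h0))
      (lt_irrefl _)
  have hgt : ∀ l ∈ (H.layer i k).erase k, k < l := fun l hl =>
    lt_of_le_of_ne (Fin.le_def.2 (H.mem_layer.1 (Finset.mem_of_mem_erase hl)).1)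
      (Finset.ne_of_mem_erase hl).symm
  have hdec : ∀ l' : Fin n, ∃ p : Fin n × ℕ, l' ∈ H.layer i (k + 1) →
      p.1 ∈ (H.layer i k).erase k ∧ H.word l' = mulRightPow (H.word p.1) (H.word k) p.2 := by
    intro l'
    by_cases hl' : l' ∈ H.layer i (k + 1)
    · obtain ⟨h1, h2, h3⟩ := H.mem_layer.1 hl'
      obtain ⟨l, m, h4, h5, h6⟩ := H.exists_eq_mulRightPow_word k (l' := l') rfl
        (Fin.lt_def.2 h1) fun j hj => Fin.le_def.2 (Nat.lt_succ_iff.1 (h2 j hj))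
      refine ⟨(l, m), fun _ => ⟨Finset.mem_erase.2 ⟨h4.ne', H.mem_layer.2
        ⟨(Fin.lt_def.1 h4).le, h5, ?_⟩⟩, h6⟩⟩
      rw [← h3, h6, headLetter_mulRightPow]
    · exact ⟨(l', 0), fun h => absurd h hl'⟩
  choose e he using hdec
  have hlen : ∀ l' ∈ H.layer i (k + 1), (e l').2 < s + 1 := by
    intro l' hl'
    have h1 := lt_length_mulRightPow (H.word (e l').1) (H.word k) (e l').2
    rw [← (he l' hl').2] at h1
    rcases Nat.eq_zero_or_pos s with h0 | hs
    · rcases hw : H.word l' with y | ⟨a, b⟩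
      · rw [hw] at h1
        have : (FreeMagma.of y).length = 1 := rfl
        omega
      · have h2 := (H.word_eq_mul hw).1
        have := (a * b).length_pos
        omega
    · have := H.length_word_le hs l'
      omega
  have hexpand : expAd (H.elt k) (x k) (∑ l ∈ (H.layer i k).erase k, H.coef x l • H.elt l) =
      ∑ p ∈ (H.layer i k).erase k ×ˢ Finset.range (s + 1),
        (H.coef x p.1 * ((-x k) ^ p.2 / p.2.factorial)) •
          evalBracket r s (mulRightPow (H.word p.1) (H.word k) p.2) := by
    rw [Finset.sum_product, map_sum]
    refine Finset.sum_congr rfl fun l _ => ?_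
    rw [map_smul, expAd_apply, Finset.smul_sum]
    refine Finset.sum_congr rfl fun m _ => ?_
    rw [ad_pow_elt, smul_smul, smul_smul, neg_pow (x k)]
    congr 1
    ring
  rw [hexpand]
  symm
  refine Finset.sum_of_injOn e ?_ ?_ ?_ ?_
  · intro a ha b hb hab
    apply H.word_injective
    rw [(he a ha).2, (he b hb).2, hab]
  · intro a ha
    exact Finset.mem_coe.2 (Finset.mem_product.2 ⟨(he a ha).1, Finset.mem_range.2 (hlen a ha)⟩)
  · rintro ⟨l, m⟩ hp hne
    have hl := (Finset.mem_product.1 hp).1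
    by_cases hs : (mulRightPow (H.word l) (H.word k) m).length ≤ s
    · obtain ⟨h1, h2, h3⟩ := H.mem_layer.1 (Finset.mem_of_mem_erase hl)
      obtain ⟨l', h4, h5, h6⟩ := H.exists_word_eq_mulRightPow (hgt l hl)
        (fun j hj => (Fin.lt_def.2 (h2 j hj)).le) hs
      have hl' : l' ∈ H.layer i (k + 1) := H.mem_layer.2 ⟨Fin.lt_def.1 h5,
        fun j hj => Nat.lt_succ_iff.2 (Fin.le_def.1 (h6 j hj)), by
          rw [h4, headLetter_mulRightPow]; exact h3⟩
      refine absurd ⟨l', Finset.mem_coe.2 hl', ?_⟩ hne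
      obtain ⟨h7, h8⟩ := he l' hl'
      have hm : (e l').2 = m := by
        have e1 := H.multiIndex_of_eq_mulRightPow h8 k
        have e2 := H.multiIndex_of_eq_mulRightPow h4 k
        rw [hzero _ h7] at e1
        rw [hzero _ hl] at e2
        simp only [if_true] at e1 e2
        omega
      have hl0 : (e l').1 = l := by
        apply H.word_injective
        rw [h4, hm] at h8
        exact (mulRightPow_injective h8).symm
      exact Prod.ext hl0 hm
    · rw [evalBracket_eq_zero (not_le.1 hs), smul_zero]
  · intro l' hl'
    obtain ⟨h7, h8⟩ := he l' hl'
    rw [H.coef_of_eq_mulRightPow x h8 (hzero _ h7), elt, ← h8]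

/-- The exponentials act one at a time. At stage `k` the term in `X_k`, if present, is fixed and
leaves the layer as a multiple of `maurerCartan x k`; the rest becomes layer `k + 1`. Layer `0` is
the generator alone. -/
theorem sum_vectorField_aux (x : Fin n → ℝ) (i : Fin r) : ∀ k ≤ n,
    H.expSuffix x 0 (H.elt (H.gen i)) =
      ∑ l : Fin n, (if (l : ℕ) < k then H.vectorField i x l else 0) • H.maurerCartan x l +
        H.expSuffix x k (∑ l ∈ H.layer i k, H.coef x l • H.elt l) := by
  intro k
  induction k with
  | zero =>
    intro _
    have hlayer : H.layer i 0 = {H.gen i} := by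
      ext l
      rw [mem_layer, Finset.mem_singleton]
      constructor
      · rintro ⟨_, h, hi⟩
        obtain ⟨y, hy⟩ := H.exists_word_eq_of (l := l) fun j => by
          by_contra h0
          exact absurd (h j (Nat.pos_of_ne_zero h0)) (Nat.not_lt_zero _)
        apply H.word_injective
        rw [gen, H.word_castLE, hy]
        rw [hy] at hi
        exact congrArg _ hi
      · rintro rfl
        refine ⟨Nat.zero_le _, fun j hj => ?_, ?_⟩
        · rw [multiIndex, gen, H.word_castLE] at hj
          exact absurd hj (lt_irrefl _)
        · rw [gen, H.word_castLE]; rfl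
    have hcoef : H.coef x (H.gen i) = 1 := by
      refine Finset.prod_eq_one fun j _ => ?_
      rw [multiIndex, gen, H.word_castLE]
      simp
    rw [hlayer, Finset.sum_singleton, hcoef]
    simp
  | succ k ih =>
    intro hk
    set κ : Fin n := ⟨k, hk⟩ with hκ
    have hB : ∀ y, H.expSuffix x k y = H.expSuffix x (k + 1) (expAd (H.elt κ) (x κ) y) :=
      H.expSuffix_apply x κ
    have hsum : ∑ l ∈ H.layer i k, H.coef x l • H.elt l =
        H.vectorField i x κ • H.elt κ + ∑ l ∈ (H.layer i k).erase κ, H.coef x l • H.elt l := by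
      rw [vectorField_apply]
      by_cases hκi : headLetter (H.word κ) = i
      · have hmem : κ ∈ H.layer i k := H.mem_layer.2
          ⟨le_rfl, fun j hj => H.lt_of_multiIndex_pos hj, hκi⟩
        rw [if_pos hκi, Finset.add_sum_erase _ (fun l => H.coef x l • H.elt l) hmem]
      · rw [if_neg hκi, zero_smul, zero_add, Finset.erase_eq_of_notMem]
        exact fun h => hκi (H.mem_layer.1 h).2.2
    have hlay : expAd (H.elt κ) (x κ) (∑ l ∈ (H.layer i k).erase κ, H.coef x l • H.elt l) =
      ∑ l ∈ H.layer i (k + 1), H.coef x l • H.elt l := H.expAd_sum_layer x i κ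
    rw [ih (by omega), hsum, hB, map_add, map_add, map_smul, expAd_self, hlay, ← add_assoc]
    congr 1
    have hmc : H.expSuffix x (k + 1) (H.vectorField i x κ • H.elt κ) =
        ∑ l : Fin n, (if l = κ then H.vectorField i x l else 0) • H.maurerCartan x l := by
      simp only [ite_smul, zero_smul, Finset.sum_ite_eq', Finset.mem_univ, if_true, map_smul]
      rfl
    rw [hmc, ← Finset.sum_add_distrib]
    refine Finset.sum_congr rfl fun l _ => ?_
    rw [← add_smul]
    congr 1
    rcases lt_trichotomy (l : ℕ) k with h | h | h
    · rw [if_pos h, if_neg (fun e => by rw [e] at h; exact lt_irrefl _ h), if_pos (by omega),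
        add_zero]
    · rw [if_neg (by omega), if_pos (Fin.ext h), if_pos (by omega), zero_add]
    · rw [if_neg (by omega), if_neg (fun e => by rw [e] at h; exact lt_irrefl _ h),
        if_neg (by omega), add_zero]

/-- The Maurer-Cartan form maps the `i`-th vector field to the `i`-th generator, up to the adjoint
action. -/
theorem sum_vectorField_smul_maurerCartan (x : Fin n → ℝ) (i : Fin r) :
    ∑ l, H.vectorField i x l • H.maurerCartan x l = H.expSuffix x 0 (H.elt (H.gen i)) := by
  rw [H.sum_vectorField_aux x i n le_rfl]
  have hlayer : H.layer i n = ∅ := by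
    ext l
    simp only [mem_layer, Finset.notMem_empty, iff_false]
    rintro ⟨h, _⟩
    exact absurd l.2 (not_lt.2 h)
  rw [hlayer]
  simp

/-! ### Extremal polynomials -/

/-- Expansion of a composition of sums; the operators need not commute, so their order is kept. -/
theorem foldl_sum_smul {M : Type*} [AddCommGroup M] [Module ℝ M] (N : ℕ) : ∀ (n : ℕ)
    (T : Fin n → Module.End ℝ M) (c : Fin n → ℕ → ℝ) (y : M),
    (List.finRange n).foldl (fun z k => ∑ m : Fin N, c k m • (T k ^ (m : ℕ)) z) y =
      ∑ α : Fin n → Fin N, (∏ k, c k (α k)) •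
        (List.finRange n).foldl (fun z k => (T k ^ (α k : ℕ)) z) y := by
  have hlin : ∀ (n : ℕ) (S : Fin n → Module.End ℝ M) (L : List (Fin n)),
      ∃ G : Module.End ℝ M, ∀ y, L.foldl (fun z k => S k z) y = G y := by
    intro n S L
    induction L with
    | nil => exact ⟨1, fun _ => rfl⟩
    | cons j L ih =>
      obtain ⟨G, hG⟩ := ih
      exact ⟨G * S j, fun y => by rw [List.foldl_cons, hG]; rfl⟩
  intro n
  induction n with
  | zero => intro T c y; simp
  | succ n ih =>
    intro T c y
    simp only [List.finRange_succ, List.foldl_cons, List.foldl_map]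
    rw [ih (fun k => T k.succ) (fun k => c k.succ), ← (Fin.consEquiv fun _ => Fin N).sum_comp,
      Fintype.sum_prod_type, Finset.sum_comm]
    refine Finset.sum_congr rfl fun α _ => ?_
    obtain ⟨G, hG⟩ := hlin n (fun k => T k.succ ^ (α k : ℕ)) (List.finRange n)
    simp only [Fin.consEquiv_apply, Fin.cons_zero, Fin.cons_succ, Fin.prod_univ_succ, hG, map_sum,
      map_smul, Finset.smul_sum, smul_smul]
    refine Finset.sum_congr rfl fun m _ => ?_
    rw [mul_comm]

theorem lie_iterate_eq (x y : FreeNilpotentLieAlgebra r s) (m : ℕ) :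
    (fun w => ⁅w, x⁆)^[m] y =
      ((-LieAlgebra.ad ℝ (FreeNilpotentLieAlgebra r s) x) ^ m) y := by
  rw [Module.End.pow_apply]
  congr 1
  funext w
  rw [LinearMap.neg_apply, LieAlgebra.ad_apply, lie_skew]

theorem iteratedBracket_eq_zero {α : Fin n → ℕ} {j : Fin n} (hj : s ≤ α j)
    (y : FreeNilpotentLieAlgebra r s) : H.iteratedBracket y α = 0 := by
  have h0 : ∀ (L : List (Fin n)), L.foldl (fun z k => (fun w => ⁅w, H.elt k⁆)^[α k] z) 0 = 0 := by
    intro L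
    induction L with
    | nil => rfl
    | cons k L ih =>
      rw [List.foldl_cons, Function.iterate_fixed (zero_lie _ :
        (fun w : FreeNilpotentLieAlgebra r s => ⁅w, H.elt k⁆) 0 = 0), ih]
  have h1 : ∀ (L : List (Fin n)) y, j ∈ L →
      L.foldl (fun z k => (fun w => ⁅w, H.elt k⁆)^[α k] z) y = 0 := by
    intro L
    induction L with
    | nil => intro y h; simp at h
    | cons k L ih =>
      intro y h
      rw [List.foldl_cons]
      rcases List.mem_cons.1 h with rfl | h
      · rw [lie_iterate_eq, neg_pow, ad_pow_eq_zero _ hj, mul_zero, LinearMap.zero_apply, h0]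
      · exact ih _ h
  exact h1 _ _ (List.mem_finRange j)

/-- Right brackets with `X_k` are powers of `-ad X_k`, whose signs cancel those of `(-x_k)^m`. -/
theorem expSuffix_zero_apply (x : Fin n → ℝ) (y : FreeNilpotentLieAlgebra r s) :
    H.expSuffix x 0 y = ∑ α : Fin n → Fin (s + 1),
      (∏ k, (-x k) ^ (α k : ℕ) / ((α k : ℕ).factorial : ℝ)) •
        H.iteratedBracket y fun k => (α k : ℕ) := by
  have h1 : ∀ (L : List (Fin n)) y, H.expList x L y = L.foldl (fun z k => ∑ m : Fin (s + 1),
      ((-x k) ^ (m : ℕ) / ((m : ℕ).factorial : ℝ)) •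
        ((-LieAlgebra.ad ℝ (FreeNilpotentLieAlgebra r s) (H.elt k)) ^ (m : ℕ)) z) y := by
    intro L
    induction L with
    | nil => intro y; rfl
    | cons k L ih =>
      intro y
      rw [expList_cons, ih, List.foldl_cons]
      congr 1
      rw [expAd_apply, Finset.sum_range]
      refine Finset.sum_congr rfl fun m _ => ?_
      rw [neg_pow (LieAlgebra.ad ℝ (FreeNilpotentLieAlgebra r s) (H.elt k)), neg_pow (x k)]
      rcases neg_one_pow_eq_or ℝ (m : ℕ) with h | h <;>
      rcases Nat.even_or_odd (m : ℕ) with h' | h' <;>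
      simp [h'.neg_one_pow, neg_div]
  rw [expSuffix, List.drop_zero, h1, foldl_sum_smul (s + 1) n
    (fun k => -LieAlgebra.ad ℝ (FreeNilpotentLieAlgebra r s) (H.elt k))
    (fun k m => (-x k) ^ m / (m.factorial : ℝ))]
  simp only [iteratedBracket, lie_iterate_eq]

/-- The linear functional on the Lie algebra with coordinates `v` in the dual Hall basis. -/
def covector (hs : 1 ≤ s) (v : Fin n → ℝ) : FreeNilpotentLieAlgebra r s →ₗ[ℝ] ℝ :=
  (H.basis hs).constr ℝ v

theorem covector_elt (hs : 1 ≤ s) (v : Fin n → ℝ) (l : Fin n) :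
    H.covector hs v (H.elt l) = v l := by
  rw [← H.basis_apply hs, covector, Module.Basis.constr_basis]

theorem covector_apply (hs : 1 ≤ s) (v : Fin n → ℝ) (y : FreeNilpotentLieAlgebra r s) :
    H.covector hs v y = ∑ k, H.coords y k * v k := by
  rw [covector, Module.Basis.constr_apply_fintype]
  simp [H.coords_eq_repr hs]

/-- The extremal polynomials express the coadjoint action on `v`. The formal sum over all
multi-indices reduces to exponents at most `s`, since higher brackets vanish. -/
theorem extremalPolynomial_eq (hs : 1 ≤ s) (i : Fin n) (v x : Fin n → ℝ) :
    H.extremalPolynomial i v x = H.covector hs v (H.expSuffix x 0 (H.elt i)) := by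
  have hphi : ∀ α, H.phi i α v * ∏ j, x j ^ α j = (∏ j, (-x j) ^ α j / ((α j).factorial : ℝ)) *
      H.covector hs v (H.iteratedBracket (H.elt i) α) := by
    intro α
    rw [prod_neg_pow_div, covector_apply, phi]
    simp only [structureConst]
    ring
  let E : (Fin n → Fin (s + 1)) ↪ (Fin n → ℕ) :=
    ⟨fun α j => (α j : ℕ), fun α β h => funext fun j => Fin.ext (congrFun h j)⟩
  rw [extremalPolynomial, finsum_eq_sum_of_support_subset (s := Finset.univ.map E)]
  · rw [Finset.sum_map, expSuffix_zero_apply, map_sum]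
    refine Finset.sum_congr rfl fun α _ => ?_
    rw [hphi, map_smul, smul_eq_mul]
    rfl
  · intro α hα
    rw [Function.mem_support, hphi] at hα
    have hlt : ∀ j, α j < s + 1 := by
      intro j
      by_contra hj
      exact hα (by rw [H.iteratedBracket_eq_zero (j := j) (by omega), map_zero, mul_zero])
    rw [Finset.coe_map]
    exact ⟨fun j => ⟨α j, hlt j⟩, by simp, rfl⟩

/-- The coefficients of the right-invariant one-form with value `v` at the origin. -/
def rightInvariantForm (hs : 1 ≤ s) (v x : Fin n → ℝ) (l : Fin n) : ℝ :=
  H.covector hs v (H.maurerCartan x l)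

theorem contDiff_rightInvariantForm (hs : 1 ≤ s) (v : Fin n → ℝ) (l : Fin n) :
    ContDiff ℝ 1 fun x => H.rightInvariantForm hs v x l :=
  H.contDiff_expList _ _ _

/-- This turns the equations of `Z_v` into the annihilation condition in the definition of an
abnormal extremal. -/
theorem sum_rightInvariantForm_mul (hs : 1 ≤ s) (v x : Fin n → ℝ) (i : Fin r) :
    ∑ l, H.rightInvariantForm hs v x l * H.vectorField i x l =
      H.extremalPolynomial (H.gen i) v x := by
  rw [H.extremalPolynomial_eq hs, ← sum_vectorField_smul_maurerCartan, map_sum]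
  refine Finset.sum_congr rfl fun l _ => ?_
  rw [map_smul, smul_eq_mul, mul_comm]
  rfl

theorem contDiff_vectorField (i : Fin r) (l : Fin n) :
    ContDiff ℝ 1 fun x => H.vectorField i x l := by
  unfold vectorField
  split_ifs
  · refine contDiff_const.mul (contDiff_prod fun j _ => ?_)
    fun_prop
  · exact contDiff_const

theorem fderiv_rightInvariantForm (hs : 1 ≤ s) (v x : Fin n → ℝ) (k l : Fin n) :
    fderiv ℝ (fun x => H.rightInvariantForm hs v x k) x (Pi.single l 1) =
      if k < l then H.covector hs v ⁅H.maurerCartan x l, H.maurerCartan x k⁆ else 0 :=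
  H.fderiv_expSuffix (H.covector hs v) (k + 1) (H.elt k) x l

/-- Right-invariant one-forms are invariant under the flows of the generating fields. -/
theorem sum_vectorField_mul_fderiv (hs : 1 ≤ s) (v x : Fin n → ℝ) (i : Fin r) (k : Fin n) :
    ∑ l, H.vectorField i x l *
        fderiv ℝ (fun x => H.rightInvariantForm hs v x k) x (Pi.single l 1) =
      -∑ l, fderiv ℝ (fun x => H.vectorField i x l) x (Pi.single k 1) *
        H.rightInvariantForm hs v x l := by
  -- The pairing of the form `ξ` with `X_i` is differentiated in `x_k` twice: by the product rule,
  -- and by `fderiv_expSuffix`, which gives brackets of Maurer-Cartan components. The same brackets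
  -- are the differences `∂ξ_k/∂x_l - ∂ξ_l/∂x_k`, so the two results combine to the claim.
  have hprod : fderiv ℝ (fun x => H.covector hs v (H.expSuffix x 0 (H.elt (H.gen i)))) x
      (Pi.single k 1) = ∑ l, (H.vectorField i x l *
        fderiv ℝ (fun x => H.rightInvariantForm hs v x l) x (Pi.single k 1) +
        fderiv ℝ (fun x => H.vectorField i x l) x (Pi.single k 1) *
          H.rightInvariantForm hs v x l) := by
    have hfun : (fun x => H.covector hs v (H.expSuffix x 0 (H.elt (H.gen i)))) =
        fun x => ∑ l, H.vectorField i x l * H.rightInvariantForm hs v x l := by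
      funext x
      rw [← sum_vectorField_smul_maurerCartan, map_sum]
      refine Finset.sum_congr rfl fun l _ => ?_
      rw [map_smul, smul_eq_mul]
      rfl
    have h1 : ∀ l, DifferentiableAt ℝ (fun x => H.vectorField i x l) x := fun l =>
      (H.contDiff_vectorField i l).differentiable one_ne_zero x
    have h2 : ∀ l, DifferentiableAt ℝ (fun x => H.rightInvariantForm hs v x l) x := fun l =>
      (H.contDiff_rightInvariantForm hs v l).differentiable one_ne_zero x
    rw [hfun, fderiv_fun_sum fun l _ => (h1 l).fun_mul (h2 l), sum_apply]
    refine Finset.sum_congr rfl fun l _ => ?_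
    rw [fderiv_fun_mul (h1 l) (h2 l)]
    simp only [add_apply, smul_apply, smul_eq_mul]
    ring
  rw [H.fderiv_expSuffix, if_pos (Nat.zero_le _), ← sum_vectorField_smul_maurerCartan, lie_sum,
    map_sum, Finset.sum_add_distrib, ← sub_eq_iff_eq_add'] at hprod
  rw [← hprod, ← Finset.sum_sub_distrib, ← Finset.sum_neg_distrib]
  refine Finset.sum_congr rfl fun l _ => ?_
  rw [fderiv_rightInvariantForm, fderiv_rightInvariantForm, lie_smul, map_smul, smul_eq_mul,
    ← lie_skew (H.maurerCartan x k) (H.maurerCartan x l), map_neg]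
  rcases lt_trichotomy k l with h | rfl | h
  · rw [if_pos h, if_neg h.not_gt]; ring
  · simp
  · rw [if_neg h.not_gt, if_pos h]; ring

theorem rightInvariantForm_add (hs : 1 ≤ s) (v w x : Fin n → ℝ) :
    H.rightInvariantForm hs (v + w) x =
      H.rightInvariantForm hs v x + H.rightInvariantForm hs w x := by
  funext l
  simp [rightInvariantForm, covector]

theorem rightInvariantForm_smul (hs : 1 ≤ s) (c : ℝ) (v x : Fin n → ℝ) :
    H.rightInvariantForm hs (c • v) x = c • H.rightInvariantForm hs v x := by
  funext l
  simp [rightInvariantForm, covector]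

/-- Brackets raise the degree and the basis is ordered by degree. Consequently `maurerCartan x l` is
`X_l` plus later Hall elements: the form is unitriangular. -/
theorem lie_elt_mem_span_Ioi (k l : Fin n) :
    ⁅H.elt k, H.elt l⁆ ∈ Submodule.span ℝ (H.elt '' Ioi l) := by
  refine Submodule.span_mono ?_ (H.lie_elt_mem_degreeSpan _ l k rfl)
  rintro _ ⟨a, ha, rfl⟩
  have := (H.word k).length_pos
  rw [mem_ofPred_eq] at ha
  exact ⟨a, H.lt_of_length_lt _ _ (by omega), rfl⟩

theorem lie_mem_span_Ioi (k l : Fin n) {y : FreeNilpotentLieAlgebra r s}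
    (hy : y ∈ Submodule.span ℝ (H.elt '' Ioi l)) :
    ⁅H.elt k, y⁆ ∈ Submodule.span ℝ (H.elt '' Ioi l) := by
  induction hy using Submodule.span_induction with
  | mem y hy =>
    obtain ⟨a, ha, rfl⟩ := hy
    exact Submodule.span_mono (image_mono (Ioi_subset_Ioi (le_of_lt ha)))
      (H.lie_elt_mem_span_Ioi k a)
  | zero => simp
  | add a b _ _ ha hb => rw [lie_add]; exact add_mem ha hb
  | smul c a _ ha => rw [lie_smul]; exact Submodule.smul_mem _ c ha

theorem expAd_sub_mem_span_Ioi (k l : Fin n) (t : ℝ) {y : FreeNilpotentLieAlgebra r s}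
    (hy : y - H.elt l ∈ Submodule.span ℝ (H.elt '' Ioi l)) :
    expAd (H.elt k) t y - H.elt l ∈ Submodule.span ℝ (H.elt '' Ioi l) := by
  have h1 : ∀ m, ((LieAlgebra.ad ℝ (FreeNilpotentLieAlgebra r s) (H.elt k)) ^ (m + 1)) y ∈
      Submodule.span ℝ (H.elt '' Ioi l) := by
    intro m
    induction m with
    | zero =>
      rw [zero_add, pow_one, LieAlgebra.ad_apply, ← sub_add_cancel y (H.elt l), lie_add]
      exact add_mem (H.lie_mem_span_Ioi k l hy) (H.lie_elt_mem_span_Ioi k l)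
    | succ m ih =>
      rw [pow_succ', Module.End.mul_apply, LieAlgebra.ad_apply]
      exact H.lie_mem_span_Ioi k l ih
  rw [expAd_apply, Finset.sum_range_succ', add_sub_assoc]
  refine add_mem (sum_mem fun m _ => Submodule.smul_mem _ _ (h1 m)) ?_
  simpa using hy

theorem maurerCartan_sub_mem_span_Ioi (x : Fin n → ℝ) (l : Fin n) :
    H.maurerCartan x l - H.elt l ∈ Submodule.span ℝ (H.elt '' Ioi l) := by
  have : ∀ (L : List (Fin n)) (y : FreeNilpotentLieAlgebra r s),
      y - H.elt l ∈ Submodule.span ℝ (H.elt '' Ioi l) →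
      H.expList x L y - H.elt l ∈ Submodule.span ℝ (H.elt '' Ioi l) := by
    intro L
    induction L with
    | nil => intro y hy; exact hy
    | cons k L ih => intro y hy; exact ih _ (H.expAd_sub_mem_span_Ioi k l _ hy)
  exact this _ _ (by simp)

/-- Right-invariant one-forms that vanish at a point are zero. -/
theorem eq_zero_of_rightInvariantForm_eq_zero (hs : 1 ≤ s) {v x : Fin n → ℝ}
    (h : H.rightInvariantForm hs v x = 0) : v = 0 := by
  have hker : ∀ l, v l = 0 := by
    intro l
    -- Downward induction: `maurerCartan x l` equals `X_l` modulo later elements, on which the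
    -- covector already vanishes.
    induction l using WellFoundedGT.induction with
    | _ l ih =>
    have hle : Submodule.span ℝ (H.elt '' Ioi l) ≤ LinearMap.ker (H.covector hs v) := by
      rw [Submodule.span_le]
      rintro _ ⟨a, ha, rfl⟩
      exact LinearMap.mem_ker.2 ((H.covector_elt hs v a).trans (ih a ha))
    have h1 := LinearMap.mem_ker.1 (hle (H.maurerCartan_sub_mem_span_Ioi x l))
    rw [map_sub, covector_elt] at h1
    have h2 : H.covector hs v (H.maurerCartan x l) = 0 := congrFun h l
    rw [h2, zero_sub, neg_eq_zero] at h1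
    exact h1
  exact funext hker

end HallBasis

/-! ### Integration of controls -/

instance : IsProbabilityMeasure unitVolume := ⟨by simp⟩

theorem uIoc_zero_subset_Icc {t : ℝ} (ht : t ∈ Icc (0 : ℝ) 1) : uIoc 0 t ⊆ Icc 0 1 := by
  rw [uIoc_of_le ht.1]
  exact fun x hx => ⟨hx.1.le, hx.2.trans ht.2⟩

theorem MeasureTheory.Integrable.intervalIntegrable_unit {E : Type*} [NormedAddCommGroup E]
    {g : ℝ → E} (hg : Integrable g unitVolume) {t : ℝ} (ht : t ∈ Icc (0 : ℝ) 1) :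
    IntervalIntegrable g volume 0 t :=
  intervalIntegrable_iff.2 (IntegrableOn.mono_set hg (uIoc_zero_subset_Icc ht))

theorem intervalIntegral_congr_unit {E : Type*} [NormedAddCommGroup E] [NormedSpace ℝ E]
    {f g : ℝ → E} (h : f =ᵐ[unitVolume] g) {t : ℝ} (ht : t ∈ Icc (0 : ℝ) 1) :
    ∫ τ in (0 : ℝ)..t, f τ = ∫ τ in (0 : ℝ)..t, g τ :=
  intervalIntegral.integral_congr_ae_restrict
    (ae_restrict_of_ae_restrict_of_subset (uIoc_zero_subset_Icc ht) h)

theorem continuous_primitive_unit {g : ℝ → ℝ} (hg : Integrable g unitVolume) :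
    Continuous fun t : Icc (0 : ℝ) 1 => ∫ τ in (0 : ℝ)..t, g τ := by
  have h := intervalIntegral.continuousOn_primitive_interval'
    (hg.intervalIntegrable_unit (right_mem_Icc.2 zero_le_one)) left_mem_uIcc
  rw [uIcc_of_le zero_le_one] at h
  exact h.comp_continuous continuous_subtype_val fun t => t.2

theorem intervalIntegral_unit_apply {ι : Type*} [Fintype ι] {g : ℝ → ι → ℝ}
    (hg : ∀ i, Integrable (fun τ => g τ i) unitVolume) {t : ℝ} (ht : t ∈ Icc (0 : ℝ) 1) (i : ι) :
    (∫ τ in (0 : ℝ)..t, g τ) i = ∫ τ in (0 : ℝ)..t, g τ i := by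
  rw [intervalIntegral.integral_of_le ht.1, intervalIntegral.integral_of_le ht.1]
  have hsub : Ioc 0 t ⊆ Icc 0 1 := fun x hx => ⟨hx.1.le, hx.2.trans ht.2⟩
  exact eval_integral (fun i => IntegrableOn.mono_set (hg i) hsub) i

section Control

variable {r : ℕ}

theorem integrable_control (u : ControlSpace r) (i : Fin r) :
    Integrable (fun τ => u τ i) unitVolume :=
  ((Lp.memLp u).eval_piLp i).integrable one_le_two

/-- Extension of a function on `[0,1]` to the real line by constants. -/
abbrev extendUnit (f : C(Icc (0 : ℝ) 1, ℝ)) (τ : ℝ) : ℝ := f (projIcc 0 1 zero_le_one τ)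

theorem continuous_extendUnit (f : C(Icc (0 : ℝ) 1, ℝ)) : Continuous (extendUnit f) :=
  f.continuous.comp continuous_projIcc

theorem extendUnit_of_mem (f : C(Icc (0 : ℝ) 1, ℝ)) {τ : ℝ} (hτ : τ ∈ Icc (0 : ℝ) 1) :
    extendUnit f τ = f ⟨τ, hτ⟩ := by
  rw [extendUnit, projIcc_of_mem]

theorem integrable_control_mul (u : ControlSpace r) (i : Fin r) {g : ℝ → ℝ}
    (hg : ContinuousOn g (Icc 0 1)) : Integrable (fun τ => u τ i * g τ) unitVolume :=
  IntegrableOn.mul_continuousOn (integrable_control u i) hg isCompact_Icc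

theorem integral_abs_control_le (u : ControlSpace r) (i : Fin r) :
    ∫ τ, |u τ i| ∂unitVolume ≤ ‖u‖ := by
  have hu : Integrable (fun τ => u τ) unitVolume := (Lp.memLp u).integrable one_le_two
  have h1 : ∫ τ, |u τ i| ∂unitVolume ≤ ∫ τ, ‖u τ‖ ∂unitVolume :=
    integral_mono (integrable_control u i).abs hu.norm fun τ => PiLp.norm_apply_le (u τ) i
  refine h1.trans ?_
  rw [integral_norm_eq_lintegral_enorm hu.aestronglyMeasurable, ← eLpNorm_one_eq_lintegral_enorm,
    Lp.norm_def]
  exact ENNReal.toReal_mono (Lp.memLp u).eLpNorm_ne_top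
    (eLpNorm_le_eLpNorm_of_exponent_le one_le_two hu.aestronglyMeasurable)

/-- The bilinear map `(f, u) ↦ (t ↦ ∫ τ in 0..t, u_i(τ) f(τ))`. -/
def controlIntegral (i : Fin r) :
    C(Icc (0 : ℝ) 1, ℝ) →L[ℝ] ControlSpace r →L[ℝ] C(Icc (0 : ℝ) 1, ℝ) :=
  LinearMap.mkContinuous₂
    (LinearMap.mk₂ ℝ
      (fun f u => (⟨fun t => ∫ τ in (0 : ℝ)..t, u τ i * extendUnit f τ, 
        continuous_primitive_unit (integrable_control_mul u i
          (continuous_extendUnit f).continuousOn)⟩ : C(Icc (0 : ℝ) 1, ℝ)))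
      (fun f g u => by
        ext t
        simp only [ContinuousMap.coe_mk, ContinuousMap.add_apply, extendUnit, mul_add]
        exact intervalIntegral.integral_add
          ((integrable_control_mul u i
            (continuous_extendUnit f).continuousOn).intervalIntegrable_unit t.2)
          ((integrable_control_mul u i
            (continuous_extendUnit g).continuousOn).intervalIntegrable_unit t.2))
      (fun c f u => by
        ext t
        simp only [ContinuousMap.coe_mk, ContinuousMap.smul_apply, extendUnit, smul_eq_mul,
          mul_left_comm _ c]
        exact intervalIntegral.integral_const_mul _ _)
      (fun f u w => by
        ext t
        simp only [ContinuousMap.coe_mk, ContinuousMap.add_apply]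
        refine Eq.trans ?_ (intervalIntegral.integral_add
          ((integrable_control_mul u i
            (continuous_extendUnit f).continuousOn).intervalIntegrable_unit t.2)
          ((integrable_control_mul w i
            (continuous_extendUnit f).continuousOn).intervalIntegrable_unit t.2))
        refine intervalIntegral_congr_unit ?_ t.2
        filter_upwards [Lp.coeFn_add u w] with τ hτ
        rw [hτ, Pi.add_apply, PiLp.add_apply, add_mul])
      (fun c f u => by
        ext t
        simp only [ContinuousMap.coe_mk, ContinuousMap.smul_apply, smul_eq_mul]
        refine Eq.trans ?_ (intervalIntegral.integral_const_mul _ _)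
        refine intervalIntegral_congr_unit ?_ t.2
        filter_upwards [Lp.coeFn_smul c u] with τ hτ
        rw [hτ, Pi.smul_apply, PiLp.smul_apply, smul_eq_mul, mul_assoc]))
    1 (fun f u => by
      rw [one_mul, ContinuousMap.norm_le _ (by positivity)]
      intro t
      simp only [LinearMap.mk₂_apply, ContinuousMap.coe_mk]
      have hint := integrable_control_mul u i (continuous_extendUnit f).continuousOn
      calc ‖∫ τ in (0 : ℝ)..t, u τ i * extendUnit f τ‖
          ≤ ∫ τ in uIoc (0 : ℝ) t, ‖u τ i * extendUnit f τ‖ :=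
            intervalIntegral.norm_integral_le_integral_norm_uIoc
        _ ≤ ∫ τ, ‖u τ i * extendUnit f τ‖ ∂unitVolume :=
            setIntegral_mono_set hint.norm (Filter.Eventually.of_forall fun _ => norm_nonneg _)
              (uIoc_zero_subset_Icc t.2).eventuallyLE
        _ ≤ ∫ τ, ‖f‖ * |u τ i| ∂unitVolume := by
            refine integral_mono hint.norm ((integrable_control u i).abs.const_mul _) fun τ => ?_
            simp only [norm_mul]
            rw [mul_comm]
            exact mul_le_mul_of_nonneg_right (f.norm_coe_le_norm _) (abs_nonneg _)
        _ ≤ ‖f‖ * ‖u‖ := by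
            rw [integral_const_mul]
            exact mul_le_mul_of_nonneg_left (integral_abs_control_le u i) (norm_nonneg _))

theorem controlIntegral_apply (i : Fin r) (f : C(Icc (0 : ℝ) 1, ℝ)) (u : ControlSpace r)
    (t : Icc (0 : ℝ) 1) :
    controlIntegral i f u t = ∫ τ in (0 : ℝ)..t, u τ i * extendUnit f τ := rfl

end Control

/-! ### Trajectories and the end-point map -/

theorem ContinuousLinearMap.hasFDerivAt_comp_left {E F G : Type*} [NormedAddCommGroup E]
    [NormedSpace ℝ E] [NormedAddCommGroup F] [NormedSpace ℝ F] [NormedAddCommGroup G]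
    [NormedSpace ℝ G] (L : F →L[ℝ] G) {f : E → F} {f' : E →L[ℝ] F} {x : E}
    (hf : HasFDerivAt f f' x) : HasFDerivAt (fun y => L (f y)) (L.comp f') x :=
  L.hasFDerivAt.comp x hf

theorem ContinuousLinearMap.hasFDerivAt_apply_self {E F G : Type*} [NormedAddCommGroup E]
    [NormedSpace ℝ E] [NormedAddCommGroup F] [NormedSpace ℝ F] [NormedAddCommGroup G]
    [NormedSpace ℝ G] (B : F →L[ℝ] E →L[ℝ] G) {q : E → F} {q' : E →L[ℝ] F} {x : E}
    (hq : HasFDerivAt q q' x) :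
    HasFDerivAt (fun y => B (q y) y) (B (q x) + (B.flip x).comp q') x :=
  (B.hasFDerivAt_comp_left hq).clm_apply (hasFDerivAt_id x)

namespace HallBasis

variable {r s n : ℕ} (H : HallBasis r s n)

theorem continuous_coef (l : Fin n) : Continuous fun x : Fin n → ℝ => H.coef x l := by
  unfold coef
  fun_prop

theorem coef_congr {x y : Fin n → ℝ} {l : Fin n} (h : ∀ j < l, x j = y j) :
    H.coef x l = H.coef y l := by
  refine Finset.prod_congr rfl fun j _ => ?_
  rcases Nat.eq_zero_or_pos (H.multiIndex l j) with h0 | h0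
  · simp [h0]
  · rw [h j (H.lt_of_multiIndex_pos h0)]

/-- The components of the trajectory that starts at the origin, as functions of the control. -/
def trajectory (l : Fin n) (u : ControlSpace r) : C(Icc (0 : ℝ) 1, ℝ) :=
  controlIntegral (headLetter (H.word l)) (∏ j : Fin n, if j < l then
    ((H.multiIndex l j).factorial : ℝ)⁻¹ • (-trajectory j u) ^ H.multiIndex l j else 1) u
termination_by l

/-- The guard `j < l` in the definition only ensures termination: for the other `j` the exponent is
zero. -/
theorem trajectory_eq (l : Fin n) (u : ControlSpace r) :
    H.trajectory l u = controlIntegral (headLetter (H.word l)) (∏ j : Fin n,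
      ((H.multiIndex l j).factorial : ℝ)⁻¹ • (-H.trajectory j u) ^ H.multiIndex l j) u := by
  rw [trajectory]
  congr 2
  refine Finset.prod_congr rfl fun j _ => ?_
  split_ifs with h
  · rfl
  · have h0 : H.multiIndex l j = 0 := by
      by_contra h0
      exact h (H.lt_of_multiIndex_pos (Nat.pos_of_ne_zero h0))
    simp [h0]

theorem prod_smul_pow_apply (φ : Fin n → C(Icc (0 : ℝ) 1, ℝ)) (l : Fin n) (t : Icc (0 : ℝ) 1) :
    (∏ j : Fin n, ((H.multiIndex l j).factorial : ℝ)⁻¹ • (-φ j) ^ H.multiIndex l j) t =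
      H.coef (fun j => φ j t) l := by
  rw [ContinuousMap.prod_apply, coef]
  refine Finset.prod_congr rfl fun j _ => ?_
  simp [div_eq_inv_mul]

theorem trajectory_apply (l : Fin n) (u : ControlSpace r) (t : Icc (0 : ℝ) 1) :
    H.trajectory l u t = ∫ τ in (0 : ℝ)..t, u τ (headLetter (H.word l)) *
      H.coef (fun j => extendUnit (H.trajectory j u) τ) l := by
  rw [trajectory_eq, controlIntegral_apply]
  simp only [extendUnit, prod_smul_pow_apply]

theorem sum_mul_vectorField (c : Fin r → ℝ) (x : Fin n → ℝ) (l : Fin n) :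
    ∑ j, c j * H.vectorField j x l = c (headLetter (H.word l)) * H.coef x l := by
  simp [vectorField_apply]

theorem integrable_control_mul_coef (u : ControlSpace r) {γ : ℝ → Fin n → ℝ}
    (hγ : ContinuousOn γ (Icc 0 1)) (i : Fin r) (l : Fin n) :
    Integrable (fun τ => u τ i * H.coef (γ τ) l) unitVolume :=
  integrable_control_mul u i ((H.continuous_coef l).comp_continuousOn hγ)

/-- Only the generator named by the head letter of `X_l` has a component along `∂/∂x_l`, so each
coordinate is driven by a single control. -/
theorem isTrajectory_iff (u : ControlSpace r) (γ : ℝ → Fin n → ℝ) :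
    IsTrajectory H.vectorField 0 u γ ↔ ContinuousOn γ (Icc 0 1) ∧ ∀ t ∈ Icc (0 : ℝ) 1, ∀ l,
      γ t l = ∫ τ in (0 : ℝ)..t, u τ (headLetter (H.word l)) * H.coef (γ τ) l := by
  refine and_congr_right fun hγ => forall₂_congr fun t ht => ?_
  have hg : ∀ τ l, (∑ j, u τ j • H.vectorField j (γ τ)) l =
      u τ (headLetter (H.word l)) * H.coef (γ τ) l := fun τ l => by
    rw [Finset.sum_apply]
    exact H.sum_mul_vectorField (fun j => u τ j) (γ τ) l
  rw [zero_add, funext_iff]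
  refine forall_congr' fun l => ?_
  rw [intervalIntegral_unit_apply (fun i => ?_) ht]
  · simp only [hg]
  · simp only [hg]
    exact H.integrable_control_mul_coef u hγ _ _

theorem isTrajectory_trajectory (u : ControlSpace r) :
    IsTrajectory H.vectorField 0 u fun t l => extendUnit (H.trajectory l u) t := by
  rw [isTrajectory_iff]
  refine ⟨(continuous_pi fun l => continuous_extendUnit _).continuousOn, fun t ht l => ?_⟩
  rw [extendUnit_of_mem _ ht, trajectory_apply]

/-- Uniqueness follows from triangularity: the velocity of `x_l` involves only earlier coordinates.
-/
theorem eq_trajectory_of_isTrajectory {u : ControlSpace r} {γ : ℝ → Fin n → ℝ}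
    (hγ : IsTrajectory H.vectorField 0 u γ) (l : Fin n) :
    ∀ t ∈ Icc (0 : ℝ) 1, γ t l = extendUnit (H.trajectory l u) t := by
  induction l using WellFoundedLT.induction with
  | _ l ih =>
  intro t ht
  rw [extendUnit_of_mem _ ht, trajectory_apply, ((H.isTrajectory_iff u γ).1 hγ).2 t ht l]
  refine intervalIntegral_congr_unit ?_ ht
  filter_upwards [ae_restrict_mem measurableSet_Icc] with τ hτ
  rw [H.coef_congr fun j hj => ih j hj τ hτ]

theorem endpointMap_eq (u : ControlSpace r) :
    endpointMap H.vectorField 0 u = fun l => H.trajectory l u 1 := by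
  obtain ⟨γ, hγ, h1⟩ := Classical.epsilon_spec
    (p := fun p => ∃ γ, IsTrajectory H.vectorField 0 u γ ∧ γ 1 = p)
    ⟨_, _, H.isTrajectory_trajectory u, rfl⟩
  have h2 : endpointMap H.vectorField 0 u = γ 1 := h1.symm
  rw [h2]
  funext l
  rw [H.eq_trajectory_of_isTrajectory hγ l 1 (right_mem_Icc.2 zero_le_one),
    extendUnit_of_mem _ (right_mem_Icc.2 zero_le_one)]
  rfl

/-! ### The differential of the trajectory -/

/-- Each component is a continuous bilinear expression in the control and a polynomial in earlier
components. -/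
theorem differentiable_trajectory (l : Fin n) : Differentiable ℝ (H.trajectory l) := by
  induction l using WellFoundedLT.induction with
  | _ l ih =>
  have h1 : H.trajectory l = fun u => controlIntegral (headLetter (H.word l)) (∏ j : Fin n,
      ((H.multiIndex l j).factorial : ℝ)⁻¹ • (-H.trajectory j u) ^ H.multiIndex l j) u :=
    funext fun u => H.trajectory_eq l u
  have h2 : ∀ j : Fin n, Differentiable ℝ fun u =>
      ((H.multiIndex l j).factorial : ℝ)⁻¹ • (-H.trajectory j u) ^ H.multiIndex l j := by
    intro j
    rcases Nat.eq_zero_or_pos (H.multiIndex l j) with h0 | h0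
    · simp [h0]
    · exact ((ih j (H.lt_of_multiIndex_pos h0)).fun_neg.fun_pow
        (H.multiIndex l j)).fun_const_smul ((H.multiIndex l j).factorial : ℝ)⁻¹
  rw [h1]
  refine Differentiable.clm_apply ((controlIntegral _).differentiable.comp fun u => ?_)
    differentiable_id
  exact (HasFDerivAt.finsetProd fun j _ => (h2 j u).hasFDerivAt).differentiableAt

theorem contDiff_coef (l : Fin n) : ContDiff ℝ 1 fun x : Fin n → ℝ => H.coef x l := by
  unfold coef
  refine contDiff_prod fun j _ => ?_
  fun_prop

/-- The linearised control system. -/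
theorem fderiv_trajectory_apply (u w : ControlSpace r) (l : Fin n) (t : Icc (0 : ℝ) 1) :
    fderiv ℝ (H.trajectory l) u w t = ∫ τ in (0 : ℝ)..t,
      (w τ (headLetter (H.word l)) * H.coef (fun j => extendUnit (H.trajectory j u) τ) l +
        u τ (headLetter (H.word l)) *
          fderiv ℝ (fun x => H.coef x l) (fun j => extendUnit (H.trajectory j u) τ)
            (fun j => extendUnit (fderiv ℝ (H.trajectory j) u w) τ)) := by
  set q : ControlSpace r → C(Icc (0 : ℝ) 1, ℝ) := fun u => ∏ j : Fin n,
      ((H.multiIndex l j).factorial : ℝ)⁻¹ • (-H.trajectory j u) ^ H.multiIndex l j with hq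
  have h1 : H.trajectory l = fun u => controlIntegral (headLetter (H.word l)) (q u) u :=
    funext fun u => H.trajectory_eq l u
  have hqd : DifferentiableAt ℝ q u :=
    (HasFDerivAt.finsetProd fun j _ => ((((H.differentiable_trajectory j).fun_neg.fun_pow
      (H.multiIndex l j)).fun_const_smul
        ((H.multiIndex l j).factorial : ℝ)⁻¹) u).hasFDerivAt).differentiableAt
  -- Evaluation at `τ` turns `q` into `coef` along the trajectory; the chain rule and uniqueness of
  -- derivatives give the formula.
  have hq_apply : ∀ τ : Icc (0 : ℝ) 1, fderiv ℝ q u w τ =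
      fderiv ℝ (fun x => H.coef x l) (fun j => H.trajectory j u τ)
        (fun j => fderiv ℝ (H.trajectory j) u w τ) := by
    intro τ
    have e1 : HasFDerivAt (fun u => q u τ)
        ((ContinuousMap.evalCLM ℝ τ).comp (fderiv ℝ q u)) u :=
      ContinuousLinearMap.hasFDerivAt_comp_left (ContinuousMap.evalCLM ℝ τ) hqd.hasFDerivAt
    have e2 : HasFDerivAt (fun (u : ControlSpace r) (j : Fin n) => H.trajectory j u τ)
        (ContinuousLinearMap.pi fun j =>
          (ContinuousMap.evalCLM ℝ τ).comp (fderiv ℝ (H.trajectory j) u)) u :=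
      hasFDerivAt_pi.2 fun j => ContinuousLinearMap.hasFDerivAt_comp_left
        (ContinuousMap.evalCLM ℝ τ) (H.differentiable_trajectory j u).hasFDerivAt
    have e3 := (((H.contDiff_coef l).differentiable one_ne_zero)
      (fun j => H.trajectory j u τ)).hasFDerivAt.comp u e2
    have e4 : (fun u => q u τ) =
        (fun x => H.coef x l) ∘ fun (u : ControlSpace r) (j : Fin n) => H.trajectory j u τ :=
      funext fun u => H.prod_smul_pow_apply _ l τ
    rw [e4] at e1
    exact DFunLike.congr_fun (e1.unique e3) w
  have h2 : fderiv ℝ (H.trajectory l) u w =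
      controlIntegral (headLetter (H.word l)) (q u) w +
        controlIntegral (headLetter (H.word l)) (fderiv ℝ q u w) u := by
    have h3 := ContinuousLinearMap.hasFDerivAt_apply_self
      (controlIntegral (headLetter (H.word l))) hqd.hasFDerivAt
    rw [h1, h3.fderiv]
    rfl
  rw [h2, ContinuousMap.add_apply, controlIntegral_apply, controlIntegral_apply,
    ← intervalIntegral.integral_add
      ((integrable_control_mul w _ (continuous_extendUnit _).continuousOn).intervalIntegrable_unit
        t.2)
      ((integrable_control_mul u _ (continuous_extendUnit _).continuousOn).intervalIntegrable_unit
        t.2)]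
  simp only [extendUnit, hq_apply]
  simp only [hq, prod_smul_pow_apply]

end HallBasis

/-! ### The adjoint equation along horizontal curves -/

theorem fderiv_apply_eq_sum {n : ℕ} {F : Type*} [NormedAddCommGroup F] [NormedSpace ℝ F]
    (L : (Fin n → ℝ) →L[ℝ] F) (y : Fin n → ℝ) : L y = ∑ k, y k • L (Pi.single k 1) := by
  conv_lhs => rw [← Finset.univ_sum_single y, map_sum]
  refine Finset.sum_congr rfl fun k _ => ?_
  rw [← map_smul, ← Pi.single_smul, smul_eq_mul, mul_one]

/-- The algebra behind the duality, with `F j i k` in the role of `∂(X_j)_i/∂x_k`: in the derivative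
of `⟨ξ, δ⟩` the adjoint and linearised terms cancel, and only the variation `w` of the control
remains. -/
theorem sum_adjoint_mul_add_mul_linearized {r n : ℕ} (X : Fin r → Fin n → ℝ)
    (F : Fin r → Fin n → Fin n → ℝ) (u w : Fin r → ℝ) (ξ δ : Fin n → ℝ) :
    ∑ k, ((-∑ j, ∑ i, F j i k * u j * ξ i) * δ k +
      ξ k * (∑ j, w j * X j k + ∑ j, u j * ∑ i, δ i * F j k i)) =
      ∑ j, w j * ∑ i, ξ i * X j i := by
  simp only [mul_add, Finset.sum_add_distrib, neg_mul, Finset.sum_neg_distrib, Finset.mul_sum,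
    Finset.sum_mul]
  have h1 : ∑ k, ∑ j, ∑ i, F j i k * u j * ξ i * δ k =
      ∑ k, ∑ j, ∑ i, ξ k * (u j * (δ i * F j k i)) := by
    rw [Finset.sum_comm]
    conv_rhs => rw [Finset.sum_comm]
    refine Finset.sum_congr rfl fun j _ => ?_
    rw [Finset.sum_comm]
    refine Finset.sum_congr rfl fun k _ => Finset.sum_congr rfl fun i _ => ?_
    ring
  have h2 : ∑ k, ∑ j, ξ k * (w j * X j k) = ∑ j, ∑ i, w j * (ξ i * X j i) := by
    rw [Finset.sum_comm]
    refine Finset.sum_congr rfl fun j _ => Finset.sum_congr rfl fun k _ => ?_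
    ring
  rw [h1, h2]
  ring

namespace IsHorizontal

variable {r n : ℕ} {X : Fin r → (Fin n → ℝ) → (Fin n → ℝ)} {γ : ℝ → (Fin n → ℝ)}
  {h : ℝ → EuclideanSpace ℝ (Fin r)} (hγ : IsHorizontal X γ h)

include hγ

theorem continuousOn : ContinuousOn γ (Icc 0 1) := by
  obtain ⟨K, hK⟩ := hγ.lipschitz
  exact hK.continuousOn

theorem coeFn_control : hγ.control =ᵐ[unitVolume] h := MemLp.coeFn_toLp _

theorem exists_lipschitzOnWith_comp {m : ℕ} {f : (Fin n → ℝ) → (Fin m → ℝ)}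
    (hf : ContDiff ℝ 1 f) : ∃ K : NNReal, LipschitzOnWith K (f ∘ γ) (Icc 0 1) := by
  obtain ⟨K, hK⟩ := hγ.lipschitz
  obtain ⟨R, hR⟩ := (isCompact_Icc.image_of_continuousOn hγ.continuousOn).isBounded.subset_closedBall
    (0 : Fin n → ℝ)
  obtain ⟨K', hK'⟩ := hf.contDiffOn.exists_lipschitzOnWith one_ne_zero
    (convex_closedBall (0 : Fin n → ℝ) R) (isCompact_closedBall _ _)
  exact ⟨K' * K, hK'.comp hK fun t ht => hR (mem_image_of_mem γ ht)⟩

end IsHorizontal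

theorem ae_unitVolume_of_ae {p : ℝ → Prop} (h : ∀ᵐ t, t ∈ uIcc (0 : ℝ) 1 → p t) :
    ∀ᵐ t ∂unitVolume, p t := by
  rw [uIcc_of_le zero_le_one] at h
  exact (ae_restrict_iff' measurableSet_Icc).2 h

namespace HallBasis

variable {r s n : ℕ} (H : HallBasis r s n)

theorem sum_control_mul_fderiv_vectorField (c : Fin r → ℝ) (x y : Fin n → ℝ) (l : Fin n) :
    ∑ j, c j * ∑ i, y i * fderiv ℝ (fun x => H.vectorField j x l) x (Pi.single i 1) =
      c (headLetter (H.word l)) * fderiv ℝ (fun x => H.coef x l) x y := by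
  have h1 : ∀ j, ∑ i, y i * fderiv ℝ (fun x => H.vectorField j x l) x (Pi.single i 1) =
      if headLetter (H.word l) = j then fderiv ℝ (fun x => H.coef x l) x y else 0 := by
    intro j
    have h2 := fderiv_apply_eq_sum (fderiv ℝ (fun x => H.vectorField j x l) x) y
    simp only [smul_eq_mul] at h2
    rw [← h2]
    simp only [vectorField_apply]
    split_ifs
    · rfl
    · simp
  simp [h1]

section Horizontal

variable {γ : ℝ → (Fin n → ℝ)} {h : ℝ → EuclideanSpace ℝ (Fin r)}
  (hγ : IsHorizontal H.vectorField γ h)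

include hγ

/-- A Lipschitz curve is absolutely continuous, hence the integral of its derivative. -/
theorem isTrajectory_control (hγ0 : γ 0 = 0) : IsTrajectory H.vectorField 0 hγ.control γ := by
  rw [isTrajectory_iff]
  refine ⟨hγ.continuousOn, fun t ht l => ?_⟩
  obtain ⟨K, hK⟩ := hγ.lipschitz
  have hsub : uIcc 0 t ⊆ Icc 0 1 := by
    rw [uIcc_of_le ht.1]
    exact Icc_subset_Icc_right ht.2
  have hac : AbsolutelyContinuousOnInterval (fun τ => γ τ l) 0 t :=
    LipschitzOnWith.absolutelyContinuousOnInterval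
      ((LipschitzWith.eval l).comp_lipschitzOnWith (hK.mono hsub))
  have hint := hac.integral_deriv_eq_sub
  rw [hγ0, Pi.zero_apply, sub_zero] at hint
  rw [← hint]
  refine intervalIntegral_congr_unit ?_ ht
  filter_upwards [hγ.hasDerivAt, hγ.coeFn_control] with τ h1 h2
  rw [(hasDerivAt_pi.1 h1 l).deriv, Finset.sum_apply, h2]
  exact H.sum_mul_vectorField (fun j => h τ j) (γ τ) l

/-- A right-invariant one-form solves the adjoint equation along a horizontal curve. -/
theorem ae_hasDerivAt_rightInvariantForm (hs : 1 ≤ s) (v : Fin n → ℝ) :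
    ∀ᵐ t ∂unitVolume, ∀ k, HasDerivAt (fun τ => H.rightInvariantForm hs v (γ τ) k)
      (-∑ j, ∑ i, fderiv ℝ (fun x => H.vectorField j x i) (γ t) (Pi.single k 1) * h t j *
        H.rightInvariantForm hs v (γ t) i) t := by
  filter_upwards [hγ.hasDerivAt] with t ht k
  have h1 := ((H.contDiff_rightInvariantForm hs v k).differentiable one_ne_zero
    (γ t)).hasFDerivAt.comp_hasDerivAt t ht
  refine h1.congr_deriv ?_
  rw [map_sum, ← Finset.sum_neg_distrib]
  refine Finset.sum_congr rfl fun j _ => ?_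
  rw [map_smul, fderiv_apply_eq_sum, smul_eq_mul]
  have h2 := H.sum_vectorField_mul_fderiv hs v (γ t) j k
  simp only [smul_eq_mul]
  rw [h2, mul_neg, Finset.mul_sum]
  congr 1
  refine Finset.sum_congr rfl fun i _ => ?_
  ring

theorem exists_lipschitzOnWith_rightInvariantForm (hs : 1 ≤ s) (v : Fin n → ℝ) :
    ∃ K : NNReal, LipschitzOnWith K (fun t => H.rightInvariantForm hs v (γ t)) (Icc 0 1) :=
  hγ.exists_lipschitzOnWith_comp (f := H.rightInvariantForm hs v)
    (contDiff_pi.2 fun l => H.contDiff_rightInvariantForm hs v l)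

/-- The pairing of the differential of the end-point map with a right-invariant one-form. -/
theorem sum_rightInvariantForm_mul_fderiv_trajectory (hγ0 : γ 0 = 0) (hs : 1 ≤ s)
    (v : Fin n → ℝ) (w : ControlSpace r) :
    ∑ l, H.rightInvariantForm hs v (γ 1) l * fderiv ℝ (H.trajectory l) hγ.control w 1 =
      ∫ τ in (0 : ℝ)..1, ∑ j, w τ j * H.extremalPolynomial (H.gen j) v (γ τ) := by
  set u := hγ.control with hu
  have htraj := H.isTrajectory_control hγ hγ0
  have hγeq : ∀ t ∈ Icc (0 : ℝ) 1, (fun j => extendUnit (H.trajectory j u) t) = γ t :=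
    fun t ht => funext fun j => (H.eq_trajectory_of_isTrajectory htraj j t ht).symm
  let δ : ℝ → Fin n → ℝ := fun τ j => extendUnit (fderiv ℝ (H.trajectory j) u w) τ
  let g : Fin n → ℝ → ℝ := fun l τ =>
    w τ (headLetter (H.word l)) * H.coef (fun j => extendUnit (H.trajectory j u) τ) l +
      u τ (headLetter (H.word l)) *
        fderiv ℝ (fun x => H.coef x l) (fun j => extendUnit (H.trajectory j u) τ) (δ τ)
  have hcont : Continuous fun τ => fun j => extendUnit (H.trajectory j u) τ :=
    continuous_pi fun j => continuous_extendUnit _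
  have hδcont : Continuous δ := continuous_pi fun j => continuous_extendUnit _
  have hg : ∀ l, Integrable (g l) unitVolume := fun l =>
    (H.integrable_control_mul_coef w hcont.continuousOn _ l).add
      (integrable_control_mul u _ ((((H.contDiff_coef l).continuous_fderiv one_ne_zero).comp
        hcont).clm_apply hδcont).continuousOn)
  have hgi : ∀ l, IntervalIntegrable (g l) volume 0 1 := fun l =>
    (hg l).intervalIntegrable_unit (right_mem_Icc.2 zero_le_one)
  -- `f` equals the variation `δ` on `[0,1]`; as a primitive it is absolutely continuous with
  -- derivative `g` almost everywhere.
  let f : Fin n → ℝ → ℝ := fun l t => ∫ τ in (0 : ℝ)..t, g l τ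
  have hfδ : ∀ l, ∀ t ∈ Icc (0 : ℝ) 1, f l t = δ t l := fun l t ht => by
    simp only [δ]
    rw [extendUnit_of_mem _ ht, fderiv_trajectory_apply]
  have hfac : ∀ l, AbsolutelyContinuousOnInterval (f l) 0 1 := fun l =>
    (hgi l).absolutelyContinuousOnInterval_intervalIntegral left_mem_uIcc
  obtain ⟨K, hK⟩ := H.exists_lipschitzOnWith_rightInvariantForm hγ hs v
  rw [← uIcc_of_le zero_le_one] at hK
  have hξac : ∀ l, AbsolutelyContinuousOnInterval
      (fun t => H.rightInvariantForm hs v (γ t) l) 0 1 := fun l =>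
    LipschitzOnWith.absolutelyContinuousOnInterval ((LipschitzWith.eval l).comp_lipschitzOnWith hK)
  -- Integration by parts; the boundary term at `0` vanishes because the initial point is not
  -- varied.
  have hparts := fun l => (hξac l).integral_deriv_mul_eq_sub (hfac l)
  have hsum : ∑ l, H.rightInvariantForm hs v (γ 1) l * fderiv ℝ (H.trajectory l) u w 1 =
      ∑ l, ∫ τ in (0 : ℝ)..1, deriv (fun t => H.rightInvariantForm hs v (γ t) l) τ * f l τ +
        H.rightInvariantForm hs v (γ τ) l * deriv (f l) τ := by
    refine Finset.sum_congr rfl fun l _ => ?_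
    have h0 : f l 0 = 0 := intervalIntegral.integral_same
    rw [hparts l, h0, mul_zero, sub_zero, hfδ l 1 (right_mem_Icc.2 zero_le_one)]
    simp only [δ]
    rw [extendUnit_of_mem _ (right_mem_Icc.2 zero_le_one)]
    rfl
  rw [hsum, ← intervalIntegral.integral_finsetSum fun l _ =>
    ((hξac l).intervalIntegrable_deriv.mul_continuousOn (hfac l).continuousOn).add
      ((hfac l).intervalIntegrable_deriv.continuousOn_mul (hξac l).continuousOn)]
  refine intervalIntegral_congr_unit ?_ (right_mem_Icc.2 zero_le_one)
  have hderiv : ∀ᵐ t ∂unitVolume, ∀ l, HasDerivAt (f l) (g l t) t := by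
    rw [ae_all_iff]
    intro l
    refine ae_unitVolume_of_ae ?_
    filter_upwards [(hgi l).ae_hasDerivAt_integral] with t ht hmem
    exact ht hmem 0 left_mem_uIcc
  filter_upwards [H.ae_hasDerivAt_rightInvariantForm hγ hs v, hderiv, hγ.coeFn_control,
    ae_restrict_mem measurableSet_Icc] with τ h1 h2 h3 h4
  have hgτ : ∀ l, g l τ = ∑ j, w τ j * H.vectorField j (γ τ) l +
      ∑ j, h τ j * ∑ i, δ τ i *
        fderiv ℝ (fun x => H.vectorField j x l) (γ τ) (Pi.single i 1) := by
    intro l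
    simp only [g]
    rw [hγeq τ h4, H.sum_mul_vectorField (fun j => w τ j), hu, h3]
    rw [H.sum_control_mul_fderiv_vectorField (fun j => h τ j)]
  simp only [(h1 _).deriv, (h2 _).deriv, hgτ, hfδ _ τ h4, ← H.sum_rightInvariantForm_mul hs]
  exact sum_adjoint_mul_add_mul_linearized (fun j i => H.vectorField j (γ τ) i)
    (fun j i k => fderiv ℝ (fun x => H.vectorField j x i) (γ τ) (Pi.single k 1))
    (fun j => h τ j) (fun j => w τ j) (H.rightInvariantForm hs v (γ τ)) (δ τ)

end Horizontal

/-! ### Corank -/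

/-- The differential of the end-point map with initial point the origin. -/
def endpointDifferential (u : ControlSpace r) : ControlSpace r →L[ℝ] (Fin n → ℝ) :=
  ContinuousLinearMap.pi fun l => (ContinuousMap.evalCLM ℝ (1 : Icc (0 : ℝ) 1)).comp
    (fderiv ℝ (H.trajectory l) u)

theorem hasFDerivAt_endpointMap (u : ControlSpace r) :
    HasFDerivAt (endpointMap H.vectorField 0) (H.endpointDifferential u) u := by
  have h1 : endpointMap H.vectorField 0 = fun u l => H.trajectory l u 1 :=
    funext H.endpointMap_eq
  rw [h1]
  exact hasFDerivAt_pi.2 fun l => ContinuousLinearMap.hasFDerivAt_comp_left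
    (ContinuousMap.evalCLM ℝ (1 : Icc (0 : ℝ) 1)) (H.differentiable_trajectory l u).hasFDerivAt

theorem mem_abnormalVariety_iff (hs : 1 ≤ s) {v x : Fin n → ℝ} : x ∈ H.abnormalVariety v ↔
    ∀ i, ∑ l, H.rightInvariantForm hs v x l * H.vectorField i x l = 0 := by
  simp only [sum_rightInvariantForm_mul]
  rfl

/-- The vectors `v` such that the curve stays in `Z_v`. -/
def abnormalCovectors (hs : 1 ≤ s) (γ : ℝ → Fin n → ℝ) : Submodule ℝ (Fin n → ℝ) where
  carrier := {v | ∀ t ∈ Icc (0 : ℝ) 1, γ t ∈ H.abnormalVariety v}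
  zero_mem' := fun t _ => by
    rw [H.mem_abnormalVariety_iff hs]
    intro i
    have : H.rightInvariantForm hs 0 (γ t) = 0 := by
      have := H.rightInvariantForm_smul hs 0 0 (γ t)
      rwa [zero_smul, zero_smul] at this
    simp [this]
  add_mem' := fun {v w} hv hw t ht => by
    have h1 := (H.mem_abnormalVariety_iff hs).1 (hv t ht)
    have h2 := (H.mem_abnormalVariety_iff hs).1 (hw t ht)
    rw [H.mem_abnormalVariety_iff hs]
    intro i
    simp only [rightInvariantForm_add, Pi.add_apply, add_mul, Finset.sum_add_distrib, h1, h2,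
      add_zero]
  smul_mem' := fun c v hv t ht => by
    have h1 := (H.mem_abnormalVariety_iff hs).1 (hv t ht)
    rw [H.mem_abnormalVariety_iff hs]
    intro i
    simp only [rightInvariantForm_smul, Pi.smul_apply, smul_eq_mul, mul_assoc, ← Finset.mul_sum,
      h1, mul_zero]

theorem liesInAbnormalVariety_iff (hs : 1 ≤ s) (γ : ℝ → Fin n → ℝ) (m : ℕ) :
    H.LiesInAbnormalVariety γ m ↔ m ≤ Module.finrank ℝ (H.abnormalCovectors hs γ) := by
  constructor
  · rintro ⟨v, hv, hmem⟩
    have hv' : LinearIndependent ℝ fun i => (⟨v i, fun t ht => mem_iInter.1 (hmem t ht) i⟩ :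
        H.abnormalCovectors hs γ) :=
      LinearIndependent.of_comp (H.abnormalCovectors hs γ).subtype hv
    simpa using hv'.fintype_card_le_finrank
  · intro hm
    let b := Module.finBasis ℝ (H.abnormalCovectors hs γ)
    refine ⟨fun i => b (Fin.castLE hm i), ?_, fun t ht => mem_iInter.2 fun i => ?_⟩
    · have h1 := b.linearIndependent.comp _ (Fin.castLE_injective hm)
      exact h1.map' (H.abnormalCovectors hs γ).subtype (Submodule.ker_subtype _)
    · exact (b (Fin.castLE hm i)).2 t ht

/-- The linear equivalence between values of right-invariant one-forms at the origin and at `x`. -/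
def rightInvariantFormEquiv (hs : 1 ≤ s) (x : Fin n → ℝ) :
    (Fin n → ℝ) ≃ₗ[ℝ] Module.Dual ℝ (Fin n → ℝ) :=
  (LinearEquiv.ofInjectiveEndo
    { toFun := fun v => H.rightInvariantForm hs v x
      map_add' := fun v w => H.rightInvariantForm_add hs v w x
      map_smul' := fun c v => H.rightInvariantForm_smul hs c v x }
    (LinearMap.ker_eq_bot.1 (LinearMap.ker_eq_bot'.2 fun _ hv =>
      H.eq_zero_of_rightInvariantForm_eq_zero hs hv))).trans (dotProductEquiv ℝ (Fin n))

section Horizontal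

variable {γ : ℝ → (Fin n → ℝ)} {h : ℝ → EuclideanSpace ℝ (Fin r)}
  (hγ : IsHorizontal H.vectorField γ h)

include hγ

/-- Testing with `w_j = P_j^v(γ)` yields a vanishing integral of a sum of squares, and continuity
upgrades this to vanishing at every time. -/
theorem mem_abnormalCovectors_iff (hs : 1 ≤ s) (v : Fin n → ℝ) :
    v ∈ H.abnormalCovectors hs γ ↔ ∀ w : ControlSpace r,
      ∫ τ in (0 : ℝ)..1, ∑ j, w τ j * H.extremalPolynomial (H.gen j) v (γ τ) = 0 := by
  constructor
  · intro hv w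
    refine Eq.trans (intervalIntegral_congr_unit (g := 0) ?_ (right_mem_Icc.2 zero_le_one)) ?_
    · filter_upwards [ae_restrict_mem measurableSet_Icc] with τ hτ
      refine Finset.sum_eq_zero fun j _ => ?_
      rw [hv τ hτ j, mul_zero]
    · simp
  · intro hw
    let p : Fin r → ℝ → ℝ := fun j τ => H.extremalPolynomial (H.gen j) v (γ τ)
    have hp : ∀ j, ContinuousOn (p j) (Icc 0 1) := fun j => by
      have h1 : ContDiff ℝ 1 fun x => H.extremalPolynomial (H.gen j) v x := by
        simp only [H.extremalPolynomial_eq hs]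
        exact H.contDiff_expList (H.covector hs v) _ _
      exact h1.continuous.comp_continuousOn hγ.continuousOn
    have hmem : MemLp (fun τ => (WithLp.toLp 2 fun j => p j τ : EuclideanSpace ℝ (Fin r))) 2
        unitVolume := by
      refine MemLp.of_eval_piLp fun j => ?_
      obtain ⟨C, hC⟩ := isCompact_Icc.exists_bound_of_continuousOn (hp j)
      exact MemLp.of_bound ((hp j).aestronglyMeasurable measurableSet_Icc) C
        (ae_restrict_of_forall_mem measurableSet_Icc hC)
    have hint : ∫ τ in (0 : ℝ)..1, ∑ j, p j τ * p j τ = 0 := by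
      refine Eq.trans ?_ (hw (hmem.toLp _))
      refine intervalIntegral_congr_unit ?_ (right_mem_Icc.2 zero_le_one)
      filter_upwards [hmem.coeFn_toLp] with τ hτ
      rw [hτ]
    intro t ht
    by_contra hne
    have hex : ∃ j, p j t ≠ 0 := by
      by_contra hall
      push Not at hall
      exact hne hall
    obtain ⟨j, hj⟩ := hex
    refine (intervalIntegral.integral_pos zero_lt_one
      (continuousOn_finsetSum _ fun j _ => (hp j).mul (hp j))
      (fun τ _ => Finset.sum_nonneg fun j _ => mul_self_nonneg _) ⟨t, ht, ?_⟩).ne' hint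
    exact Finset.sum_pos' (fun j _ => mul_self_nonneg _)
      ⟨j, Finset.mem_univ j, mul_self_pos.2 hj⟩

/-- By the integral formula, a right-invariant form at `γ 1` kills the image of the differential
exactly when its extremal polynomials integrate to zero against all controls along `γ`. -/
theorem map_abnormalCovectors (hγ0 : γ 0 = 0) (hs : 1 ≤ s) :
    (H.abnormalCovectors hs γ).map (H.rightInvariantFormEquiv hs (γ 1)).toLinearMap =
      (LinearMap.range (H.endpointDifferential hγ.control).toLinearMap).dualAnnihilator := by
  have key : ∀ v, v ∈ H.abnormalCovectors hs γ ↔ H.rightInvariantFormEquiv hs (γ 1) v ∈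
      (LinearMap.range (H.endpointDifferential hγ.control).toLinearMap).dualAnnihilator := by
    intro v
    rw [H.mem_abnormalCovectors_iff hγ hs, Submodule.mem_dualAnnihilator]
    constructor
    · rintro hv _ ⟨w, rfl⟩
      exact (H.sum_rightInvariantForm_mul_fderiv_trajectory hγ hγ0 hs v w).trans (hv w)
    · intro hv w
      exact (H.sum_rightInvariantForm_mul_fderiv_trajectory hγ hγ0 hs v w).symm.trans
        (hv _ ⟨w, rfl⟩)
  ext φ
  constructor
  · rintro ⟨v, hv, rfl⟩
    exact (key v).1 hv
  · intro hφ
    refine ⟨(H.rightInvariantFormEquiv hs (γ 1)).symm φ, (key _).2 ?_, by simp⟩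
    rwa [LinearEquiv.apply_symm_apply]

/-- The corank of a horizontal curve is the dimension of the space of `v` such that the curve stays
in `Z_v`. -/
theorem hasCorank_iff (hγ0 : γ 0 = 0) (hs : 1 ≤ s) (k : ℕ) :
    hγ.HasCorank k ↔ k = Module.finrank ℝ (H.abnormalCovectors hs γ) := by
  have hD := H.hasFDerivAt_endpointMap hγ.control
  have h1 := Subspace.finrank_add_finrank_dualAnnihilator_eq
    (LinearMap.range (H.endpointDifferential hγ.control).toLinearMap)
  rw [← H.map_abnormalCovectors hγ hγ0 hs, LinearEquiv.finrank_map_eq,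
    Module.finrank_fin_fun] at h1
  constructor
  · rintro ⟨D, hD', hk⟩
    rw [hγ0] at hD'
    rw [hD'.unique hD] at hk
    omega
  · intro hk
    refine ⟨H.endpointDifferential hγ.control, by rw [hγ0]; exact hD, ?_⟩
    omega

theorem isAbnormalExtremal_of_mem (hs : 1 ≤ s) {v : Fin n → ℝ} (hv : v ∈ H.abnormalCovectors hs γ)
    (hv0 : v ≠ 0) : IsAbnormalExtremal H.vectorField γ h := by
  refine ⟨fun t => H.rightInvariantForm hs v (γ t),
    H.exists_lipschitzOnWith_rightInvariantForm hγ hs v, fun t _ h0 => hv0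
      (H.eq_zero_of_rightInvariantForm_eq_zero hs h0), fun t ht j => ?_,
    H.ae_hasDerivAt_rightInvariantForm hγ hs v⟩
  exact (H.mem_abnormalVariety_iff hs).1 (hv t ht) j

theorem isAbnormalExtremal_of_liesInAbnormalVariety (hs : 1 ≤ s) {m : ℕ} (hm : 1 ≤ m)
    (hl : H.LiesInAbnormalVariety γ m) : IsAbnormalExtremal H.vectorField γ h := by
  obtain ⟨v, hv, hmem⟩ := hl
  exact H.isAbnormalExtremal_of_mem hγ hs (v := v ⟨0, hm⟩)
    (fun t ht => mem_iInter.1 (hmem t ht) _) (hv.ne_zero _)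

end Horizontal

end HallBasis

end

theorem mainTheorem2 (r s n : ℕ) (hr : 2 ≤ r) (hs : 2 ≤ s) (H : HallBasis r s n)
    (γ : ℝ → (Fin n → ℝ)) (h : ℝ → EuclideanSpace ℝ (Fin r))
    (hγ : IsHorizontal H.vectorField γ h) (hγ0 : γ 0 = 0) (m : ℕ) (hm : 1 ≤ m) :
    ((IsAbnormalExtremal H.vectorField γ h ∧ ∃ k, m ≤ k ∧ hγ.HasCorank k) ↔
        H.LiesInAbnormalVariety γ m) ∧
      ((IsAbnormalExtremal H.vectorField γ h ∧ hγ.HasCorank m) ↔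
        H.LiesInAbnormalVariety γ m ∧ ¬ H.LiesInAbnormalVariety γ (m + 1)) := by
  have hs1 : 1 ≤ s := one_le_two.trans hs
  -- Since `m ≥ 1`, condition (B) supplies a nonzero `v` and hence abnormality; what remains is to
  -- compare `m` with the dimension of `abnormalCovectors`.
  have hab := H.isAbnormalExtremal_of_liesInAbnormalVariety hγ hs1 hm
  rw [H.liesInAbnormalVariety_iff hs1] at hab
  simp only [H.hasCorank_iff hγ hγ0 hs1, H.liesInAbnormalVariety_iff hs1]
  refine ⟨⟨?_, fun hle => ⟨hab hle, _, hle, rfl⟩⟩, ⟨?_, fun hle => ⟨hab hle.1, by omega⟩⟩⟩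
  · rintro ⟨_, k, hk, rfl⟩
    exact hk
  · rintro ⟨_, hk⟩
    omega
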